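/- Let $d\ge 1$, $\boldsymbol\tau\in(0,\infty)^d$, $|\boldsymbol z|=z_1+\cdots+z_d$, $\boldsymbol p=\boldsymbol\tau/|\boldsymbol\tau|$, and let $\boldsymbol u=\{u^{(l)}\}_{l=0}^{d-1}\subset\mathbb R^d$ be a basis of $\mathbb R^d$ with $u^{(0)}\equiv1$ and $\sum_{j=1}^d u^{(k)}_ju^{(l)}_jp_j=\delta_{kl}a_k$. Let $f(\cdot,\boldsymbol\tau)$ be the density of independent $N(0,\tau_i)$ variables, $i=1,\dots,d$, and let $H_n(x;v)$ be the Hermite–Chebycheff polynomials, $\sum_n H_n(x;v)z^n/n!=\exp(xz-\tfrac12vz^2)$. For $\boldsymbol n=(n_0,\dots,n_{d-1})\in\mathbb N^d$ put $H_{\boldsymbol n}(\boldsymbol x;\boldsymbol\tau,\boldsymbol u)=\prod_{j=0}^{d-1}H_{n_j}\big(\sum_i u^{(j)}_ix_i;|\boldsymbol\tau|a_j\big)$ and $h_{\boldsymbol n}=\big(\prod_{j} n_j!\,(|\boldsymbol\tau|a_j)^{n_j}\big)^{-1}$, the inverse of $\mathbb E[H_{\boldsymbol n}(\boldsymbol X;\boldsymbol\tau,\boldsymbol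 u)^2]$ for $\boldsymbol X$ with density $f(\cdot,\boldsymbol\tau)$. Let $(\rho_{\boldsymbol n})$ be real numbers with $\rho_{\boldsymbol 0}=1$, and consider the expansion $$f(\boldsymbol x,\boldsymbol\tau)f(\boldsymbol y,\boldsymbol\tau)\Big\{1+\sum_{|\boldsymbol n|\ge1}\rho_{\boldsymbol n}h_{\boldsymbol n}H_{\boldsymbol n}(\boldsymbol x;\boldsymbol\tau,\boldsymbol u)H_{\boldsymbol n}(\boldsymbol y;\boldsymbol\tau,\boldsymbol u)\Big\}.\qquad(*)$$ As the series need not converge, $(*)$ is called non-negative if, integrated term by term against any polynomial $q(\boldsymbol x,\boldsymbol y)$ with $q\ge0$ on $\mathbb R^{2d}$, it gives a non-negative number (only finitely many terms are non-zero). A probability law of $(\boldsymbol X,\boldsymbol Y)$ on $\mathbb R^{2d}$ is said to have the expansion $(*)$ if $\boldsymbol X$ and $\boldsymbol Y$ both have density $f(\cdot,\boldsymbol\tau)$ and $\mathbb E[H_{\boldsymbol m}(\boldsymbol X;\boldsymbol\tau,\boldsymbol u)H_{\boldsymbol n}(\boldsymbol Y;\boldsymbol\tau,\boldsymbol u)]=\delta_{\boldsymbol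 m\boldsymbol n}\rho_{\boldsymbol n}h_{\boldsymbol n}^{-1}$ for all $\boldsymbol m,\boldsymbol n$. Then: 1. $(*)$ is non-negative if and only if there is a random vector $\boldsymbol\xi$ in $[-1,1]^d$ with $$\rho_{\boldsymbol n}=\mathbb E\Big[\prod_{j=0}^{d-1}\xi_j^{n_j}\Big]\quad\text{for all }\boldsymbol n;\qquad(**)$$ and also if and only if some probability law has the expansion $(*)$. 2. Suppose that a law of $(\boldsymbol X,\boldsymbol Y)$ has the expansion $(*)$, and let $\varphi$ be a probability law on $[-1,1]^d$. Then $(**)$ for $\boldsymbol\xi$ of law $\varphi$ is equivalent to the following: $(\boldsymbol X,\boldsymbol Y)$ can be realized jointly with a $\boldsymbol\xi$ of law $\varphi$ so that, conditional on $\boldsymbol\xi$, it is a jointly normal pair of random vectors, each with independent entries, with means $(\boldsymbol 0,\boldsymbol 0)$, variances $(\boldsymbol\tau,\boldsymbol\tau)$ and cross covariances $$v_{ij}(\boldsymbol\xi)=\mathrm{Cov}(X_i,Y_j\mid\boldsymbol\xi)=|\boldsymbol\tau|p_ip_j\sum_{l=0}^{d-1}\xi_la_l^{-1}u^{(l)}_iu^{(l)}_j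 .$$ Conversely, if $(**)$ holds for $\boldsymbol\xi$ of law $\varphi$, then every pair $(\boldsymbol X,\boldsymbol Y)$ with this conditional structure has the expansion $(*)$. 3. The series in $(*)$ converges in mean square with respect to $f(\boldsymbol x,\boldsymbol\tau)f(\boldsymbol y,\boldsymbol\tau)\,d\boldsymbol x\,d\boldsymbol y$ if and only if $\sum_{\boldsymbol n}\rho_{\boldsymbol n}^2<\infty$. In that case the function $(*)$ is non-negative almost everywhere if and only if $(**)$ holds for some random vector $\boldsymbol\xi$ in $[-1,1]^d$, and then $(*)$ is the density of a probability law which has the expansion $(*)$. -/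

import Mathlib

open MeasureTheory ProbabilityTheory Filter Topology

namespace HermiteLancaster

noncomputable section

/-- The total `|z| = z₁ + ⋯ + z_d` of a vector. -/
def total {d : ℕ} (z : Fin d → ℝ) : ℝ := ∑ i, z i

/-- The probability vector `p = τ / |τ|`. -/
def prob {d : ℕ} (τ : Fin d → ℝ) (i : Fin d) : ℝ := τ i / total τ

/-- `u` is a complete orthogonal set of functions on the probability vector `p`, with
`u⁽⁰⁾ ≡ 1` and squared norms `a`. The value `u_i⁽ˡ⁾` is written `u l i`. -/
structure IsOrthogonalBasis {d : ℕ} [NeZero d] (p : Fin d → ℝ) (u : Fin d → Fin d → ℝ)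
    (a : Fin d → ℝ) : Prop where
  zero_eq_one : ∀ i, u 0 i = 1
  orthogonal : ∀ k l, ∑ j, u k j * u l j * p j = if k = l then a k else 0
  complete : LinearIndependent ℝ u

/-- The one-dimensional Hermite-Chebycheff polynomial `H_n(x; v)`, for a variance `v > 0`, with
generating function `∑ H_n(x; v) zⁿ / n! = exp (x z - v z² / 2)`. -/
def hermiteCheb (v : ℝ) (n : ℕ) (x : ℝ) : ℝ :=
  Real.sqrt v ^ n * Polynomial.aeval (x / Real.sqrt v) (Polynomial.hermite n)

/-- The linear form `x̂_j = ∑ i, u_i⁽ʲ⁾ x_i`. -/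
def hat {d : ℕ} (u : Fin d → Fin d → ℝ) (x : Fin d → ℝ) (j : Fin d) : ℝ := ∑ i, u j i * x i

/-- The multivariate Hermite-Chebycheff polynomial
`H_n(x; τ, u) = ∏ j, H_{n_j}(x̂_j; |τ| a_j)`. -/
def multiHermite {d : ℕ} (τ : Fin d → ℝ) (u : Fin d → Fin d → ℝ) (a : Fin d → ℝ)
    (n : Fin d → ℕ) (x : Fin d → ℝ) : ℝ :=
  ∏ j, hermiteCheb (total τ * a j) (n j) (hat u x j)

/-- `h_n`, the inverse of the squared norm `∏ j, n_j! (|τ| a_j) ^ n_j` of `H_n(·; τ, u)`. -/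
def hInv {d : ℕ} (τ a : Fin d → ℝ) (n : Fin d → ℕ) : ℝ :=
  (∏ j, ((n j).factorial : ℝ) * (total τ * a j) ^ n j)⁻¹

/-- The law of a vector of independent centred normal variables with variances `τ`. -/
def normalLaw {d : ℕ} (τ : Fin d → ℝ) : Measure (Fin d → ℝ) :=
  Measure.pi fun i => gaussianReal 0 (τ i).toNNReal

/-- The term of index `n` of the diagonal expansion. -/
def term {d : ℕ} (τ : Fin d → ℝ) (u : Fin d → Fin d → ℝ) (a : Fin d → ℝ)
    (ρ : (Fin d → ℕ) → ℝ) (n : Fin d → ℕ) (z : (Fin d → ℝ) × (Fin d → ℝ)) : ℝ :=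
  ρ n * hInv τ a n * multiHermite τ u a n z.1 * multiHermite τ u a n z.2

/-- Non-negativity of the (in general divergent) expansion
`f(x) f(y) ∑ n, ρ_n h_n H_n(x) H_n(y)`: integrated term by term against a polynomial `q(x, y)`
which is non-negative everywhere, it gives a non-negative number. The sum below has only
finitely many non-zero terms, as `H_n` is orthogonal to all polynomials of degree less
than `|n|`. -/
def ExpansionNonneg {d : ℕ} (τ : Fin d → ℝ) (u : Fin d → Fin d → ℝ) (a : Fin d → ℝ)
    (ρ : (Fin d → ℕ) → ℝ) : Prop :=
  ∀ q : MvPolynomial (Fin d ⊕ Fin d) ℝ,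
    (∀ x y : Fin d → ℝ, 0 ≤ MvPolynomial.eval (Sum.elim x y) q) →
    0 ≤ ∑' n, ∫ z, MvPolynomial.eval (Sum.elim z.1 z.2) q * term τ u a ρ n z
      ∂((normalLaw τ).prod (normalLaw τ))

/-- The law `μ` of a pair `(X, Y)` is a Lancaster distribution with the given expansion: `X` and
`Y` have the normal marginal law, and `E[H_m(X) H_n(Y)] = δ_{mn} ρ_n / h_n`. -/
structure HasExpansion {d : ℕ} (τ : Fin d → ℝ) (u : Fin d → Fin d → ℝ) (a : Fin d → ℝ)
    (ρ : (Fin d → ℕ) → ℝ) (μ : Measure ((Fin d → ℝ) × (Fin d → ℝ))) : Prop where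
  fst_eq : μ.fst = normalLaw τ
  snd_eq : μ.snd = normalLaw τ
  integrable : ∀ m n : Fin d → ℕ,
    Integrable (fun z => multiHermite τ u a m z.1 * multiHermite τ u a n z.2) μ
  integral_eq : ∀ m n : Fin d → ℕ,
    ∫ z, multiHermite τ u a m z.1 * multiHermite τ u a n z.2 ∂μ =
      if m = n then ρ n / hInv τ a n else 0

/-- The series `∑ n, ρ_n h_n H_n(x) H_n(y)` converges to `k(x, y)` in `L²` of the product of the
two marginal laws, so that the expansion is the function `f(x) f(y) k(x, y)`. -/
def IsL2Sum {d : ℕ} (τ : Fin d → ℝ) (u : Fin d → Fin d → ℝ) (a : Fin d → ℝ)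
    (ρ : (Fin d → ℕ) → ℝ) (k : (Fin d → ℝ) × (Fin d → ℝ) → ℝ) : Prop :=
  MemLp k 2 ((normalLaw τ).prod (normalLaw τ)) ∧
    Tendsto (fun s : Finset (Fin d → ℕ) =>
      eLpNorm (fun z => k z - ∑ n ∈ s, term τ u a ρ n z) 2 ((normalLaw τ).prod (normalLaw τ)))
      atTop (𝓝 0)

/-- `φ` is the law of a random vector `ξ` with elements in `[-1, 1]`. -/
structure IsCubeLaw {d : ℕ} (φ : Measure (Fin d → ℝ)) : Prop where
  isProbabilityMeasure : IsProbabilityMeasure φ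
  mem_Icc : ∀ᵐ ξ ∂φ, ∀ j, ξ j ∈ Set.Icc (-1 : ℝ) 1

/-- `ρ_n = E[∏ j, ξ_j ^ n_j]` for all `n`, where `ξ` has law `φ`. -/
def HasMoments {d : ℕ} (φ : Measure (Fin d → ℝ)) (ρ : (Fin d → ℕ) → ℝ) : Prop :=
  ∀ n, ρ n = ∫ ξ, ∏ j, ξ j ^ n j ∂φ

/-- The cross covariance matrix
`v_ij(ξ) = |τ| p_i p_j ∑ l, ξ_l a_l⁻¹ u_i⁽ˡ⁾ u_j⁽ˡ⁾`. -/
def crossCov {d : ℕ} (τ : Fin d → ℝ) (u : Fin d → Fin d → ℝ) (a : Fin d → ℝ)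
    (ξ : Fin d → ℝ) : Matrix (Fin d) (Fin d) ℝ :=
  Matrix.of fun i j =>
    total τ * prob τ i * prob τ j * ∑ l, ξ l * (a l)⁻¹ * u l i * u l j

/-- `ν` is the law of a jointly normal pair `(X, Y)` of random vectors, each with independent
entries, with means `0`, variances `τ` and cross covariances `Cov(X_i, Y_j) = V i j`. -/
structure IsNormalPair {d : ℕ} (τ : Fin d → ℝ) (V : Matrix (Fin d) (Fin d) ℝ)
    (ν : Measure ((Fin d → ℝ) × (Fin d → ℝ))) : Prop where
  isGaussian : IsGaussian ν
  mean_fst : ∀ i, ∫ z, z.1 i ∂ν = 0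
  mean_snd : ∀ i, ∫ z, z.2 i ∂ν = 0
  cov_fst : ∀ i j, cov[fun z => z.1 i, fun z => z.1 j; ν] = if i = j then τ i else 0
  cov_snd : ∀ i j, cov[fun z => z.2 i, fun z => z.2 j; ν] = if i = j then τ i else 0
  cov_cross : ∀ i j, cov[fun z => z.1 i, fun z => z.2 j; ν] = V i j

/-- `μ` is the law of a pair `(X, Y)` which, conditionally on a random vector `ξ` of law `φ`, is
jointly normal with means `0`, variances `τ` and cross covariance matrix `V(ξ)`: the kernel `κ`
is the conditional law of `(X, Y)` given `ξ`. -/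
def IsConditionallyNormal {d : ℕ} (τ : Fin d → ℝ) (u : Fin d → Fin d → ℝ) (a : Fin d → ℝ)
    (φ : Measure (Fin d → ℝ)) (μ : Measure ((Fin d → ℝ) × (Fin d → ℝ))) : Prop :=
  ∃ κ : Kernel (Fin d → ℝ) ((Fin d → ℝ) × (Fin d → ℝ)), IsMarkovKernel κ ∧
    (∀ᵐ ξ ∂φ, IsNormalPair τ (crossCov τ u a ξ) (κ ξ)) ∧ μ = φ.bind κ

end

end HermiteLancaster

namespace HermiteLancaster

/-! Whitening by the basis `u` turns `X` and `Y` into standard normal vectors, turns the polynomials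
`H_n` into multiples of the Hermite products `psi n`, and turns the cross covariance `crossCov τ u a
ξ` into the diagonal matrix of correlations `ξ_j`. Mehler's formula then reads `E[ψ_m(X) ψ_n(Y)] =
δ_{mn} n! ∏ ξ_j ^ n_j`, so mixing over `ξ` of law `φ` produces the expansion whose coefficients are
the moments of `φ` (`integral_psi_pairLaw`, `IsConditionallyNormal.properties`). A law with normal
marginals has exponential moments, hence is determined by its Hermite moments (`ext_of_psi`). This
identifies every law having the expansion with the mixture. Integrating a polynomial term by term
gives its expectation under such a law, so the expansion is non-negative.

The hard direction recovers `φ` from non-negativity, using two families of test polynomials. The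
square of `ψ_n(x) - ψ_n(y)` gives `ρ_n ≤ 1`. If `r ≥ 0` on `ℝᵈ`, then for large `K` the expression
`∏ x_j ^ (2K) · r(y / x)`, in whitened coordinates, is a non-negative polynomial. Dividing its
integral by the `d`-th power of the Gaussian moment of order `2K` and letting `K → ∞` isolates `∑
r_n ρ_n ≥ 0`. With `ρ ≤ 1` on even pure powers, positivity on `ℝᵈ` improves to positivity on the
cube (`momentFunctional_nonneg_of_cube`). The Riesz extension and Riesz-Markov-Kakutani theorems
then yield `φ`.

In mean square, the normalized products `ψ_n(x) ψ_n(y)` are orthonormal, so convergence means `∑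
ρ_n² < ∞`. For a limit `k`, determinacy compares `k` times the product law with the mixture, once
the negative part of `k` is moved to the other side. -/

open Polynomial in
/-- The Hermite polynomial with real coefficients. -/
noncomputable def herm (n : ℕ) : Polynomial ℝ := (hermite n).map (Int.castRingHom ℝ)

/-! ### One-variable Hermite polynomials: recurrences and derivatives. -/

section Herm

open Polynomial

lemma aeval_hermite (n : ℕ) (x : ℝ) : aeval x (hermite n) = (herm n).eval x := by
  simp [herm, eval_map, aeval_def]

lemma herm_zero : herm 0 = 1 := by simp [herm]

lemma herm_one : herm 1 = X := by simp [herm]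

lemma herm_succ (n : ℕ) : herm (n + 1) = X * herm n - derivative (herm n) := by
  simp [herm, hermite_succ, derivative_map]

lemma natDegree_herm (n : ℕ) : (herm n).natDegree = n := by
  rw [herm, (hermite_monic n).natDegree_map, natDegree_hermite]

lemma coeff_herm_self (n : ℕ) : (herm n).coeff n = 1 := by
  simp [herm]

lemma derivative_herm_succ (n : ℕ) : derivative (herm (n + 1)) = C ((n : ℝ) + 1) * herm n := by
  induction n with
  | zero => simp [herm_one, herm_zero]
  | succ n ih =>
    rw [herm_succ (n + 1), derivative_sub, derivative_mul, derivative_X, ih, derivative_C_mul,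
      herm_succ n]
    simp only [Nat.cast_add, Nat.cast_one, C_add, C_1]
    ring

lemma X_mul_herm_succ (n : ℕ) :
    X * herm (n + 1) = herm (n + 2) + C ((n : ℝ) + 1) * herm n := by
  rw [herm_succ (n + 1), derivative_herm_succ]; ring

lemma iterate_derivative_herm_self (n : ℕ) : derivative^[n] (herm n) = C (n.factorial : ℝ) := by
  induction n with
  | zero => simp [herm_zero]
  | succ n ih =>
    rw [Function.iterate_succ_apply, derivative_herm_succ, iterate_derivative_C_mul, ih,
      Nat.factorial_succ, ← C_mul]
    push_cast; rfl

end Herm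

/-! ### Gaussian integration by parts, orthogonality and moment asymptotics. -/

section GaussianMoments

open Polynomial

/-- The standard normal law on the line. -/
noncomputable abbrev stdGauss : Measure ℝ := gaussianReal 0 1

lemma integrable_eval_stdGauss (p : Polynomial ℝ) : Integrable (fun x => p.eval x) stdGauss := by
  induction p using Polynomial.induction_on' with
  | add p q hp hq => simp only [eval_add]; exact hp.add hq
  | monomial n c =>
    simp only [eval_monomial]
    refine Integrable.const_mul ?_ c
    have h : MemLp (fun x : ℝ => x) (n : ENNReal) stdGauss :=
      memLp_id_gaussianReal' (μ := 0) (v := 1) n (by simp)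
    have := h.integrable_norm_pow'
    refine (integrable_norm_iff (by fun_prop)).1 (by simpa using this)

lemma hasDerivAt_gaussianPDFReal_std (x : ℝ) :
    HasDerivAt (gaussianPDFReal 0 1) (-(x * gaussianPDFReal 0 1 x)) x := by
  have : gaussianPDFReal 0 1 = fun x => (√(2 * Real.pi))⁻¹ * Real.exp (-x ^ 2 / 2) := by
    ext x; simp [gaussianPDFReal]
  rw [this]
  have h : HasDerivAt (fun x : ℝ => -x ^ 2 / 2) (-x) x := by
    have := ((hasDerivAt_pow 2 x).neg).div_const 2
    refine this.congr_deriv ?_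
    norm_num
    ring
  refine (h.exp.const_mul ((√(2 * Real.pi))⁻¹)).congr_deriv ?_
  simp
  ring

/-- Gaussian integration by parts for polynomials. -/
lemma integral_X_mul_stdGauss (p : Polynomial ℝ) :
    ∫ x, (X * p).eval x ∂stdGauss = ∫ x, (derivative p).eval x ∂stdGauss := by
  have hint (q : Polynomial ℝ) : Integrable (fun x => gaussianPDFReal 0 1 x * q.eval x) := by
    have := integrable_eval_stdGauss q
    rw [stdGauss, gaussianReal_of_var_ne_zero _ one_ne_zero,
      integrable_withDensity_iff_integrable_smul' (measurable_gaussianPDF 0 1)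
        (by simp [gaussianPDF_lt_top])] at this
    simpa [toReal_gaussianPDF] using this
  simp only [stdGauss]
  rw [integral_gaussianReal_eq_integral_smul one_ne_zero,
    integral_gaussianReal_eq_integral_smul one_ne_zero]
  have := integral_mul_deriv_eq_deriv_mul_of_integrable (u := fun x => p.eval x)
    (u' := fun x => (derivative p).eval x) (v := gaussianPDFReal 0 1)
    (v' := fun x => -(x * gaussianPDFReal 0 1 x))
    (fun x _ => p.hasDerivAt x) (fun x _ => hasDerivAt_gaussianPDFReal_std x)
    (by
      refine (hint (-(X * p))).congr (ae_of_all _ fun x => ?_)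
      simp; ring)
    (by
      refine (hint (derivative p)).congr (ae_of_all _ fun x => ?_)
      simp; ring)
    (by
      refine (hint p).congr (ae_of_all _ fun x => ?_)
      simp; ring)
  simp only [smul_eq_mul, eval_mul, eval_X]
  calc _ = -∫ x, p.eval x * -(x * gaussianPDFReal 0 1 x) := by
        rw [← integral_neg]; congr 1; ext x; ring
    _ = _ := by rw [this, neg_neg]; congr 1; ext x; ring

lemma integral_herm_succ_mul (n : ℕ) (p : Polynomial ℝ) :
    ∫ x, (herm (n + 1) * p).eval x ∂stdGauss = ∫ x, (herm n * derivative p).eval x ∂stdGauss := by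
  have h1 : herm (n + 1) * p = X * (herm n * p) - derivative (herm n) * p := by
    rw [herm_succ]; ring
  rw [h1]
  simp only [eval_sub]
  rw [integral_sub (integrable_eval_stdGauss _) (integrable_eval_stdGauss _),
    integral_X_mul_stdGauss, ← integral_sub (integrable_eval_stdGauss _)
      (integrable_eval_stdGauss _)]
  congr 1; ext x
  rw [derivative_mul]
  simp

/-- Each integration by parts lowers the Hermite index by one and differentiates `p`. Orthogonality
to lower degrees is then the vanishing of the `n`-th derivative. -/
lemma integral_herm_mul (n : ℕ) (p : Polynomial ℝ) :
    ∫ x, (herm n * p).eval x ∂stdGauss = ∫ x, (derivative^[n] p).eval x ∂stdGauss := by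
  induction n generalizing p with
  | zero => simp [herm_zero]
  | succ n ih => rw [integral_herm_succ_mul, ih, Function.iterate_succ_apply]

lemma integral_herm_mul_eq_zero {n : ℕ} {p : Polynomial ℝ} (h : p.natDegree < n) :
    ∫ x, (herm n * p).eval x ∂stdGauss = 0 := by
  rw [integral_herm_mul, iterate_derivative_eq_zero h]; simp

lemma integral_herm_mul_herm (m n : ℕ) :
    ∫ x, (herm m).eval x * (herm n).eval x ∂stdGauss = if m = n then (n.factorial : ℝ) else 0 := by
  simp only [← eval_mul]
  rcases lt_trichotomy m n with h | rfl | h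
  · rw [if_neg h.ne, mul_comm, integral_herm_mul_eq_zero (by rwa [natDegree_herm])]
  · rw [integral_herm_mul, iterate_derivative_herm_self]; simp
  · rw [if_neg h.ne', integral_herm_mul_eq_zero (by rwa [natDegree_herm])]

lemma integral_pow_mul_herm_self (n : ℕ) :
    ∫ x, x ^ n * (herm n).eval x ∂stdGauss = (n.factorial : ℝ) := by
  have := integral_herm_mul n (X ^ n)
  rw [iterate_derivative_X_pow_eq_smul] at this
  simpa [mul_comm, Nat.descFactorial_self] using this

lemma integral_pow_mul_herm_of_lt {n k : ℕ} (h : n < k) :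
    ∫ x, x ^ n * (herm k).eval x ∂stdGauss = 0 := by
  have := integral_herm_mul_eq_zero (n := k) (p := X ^ n) (by simpa using h)
  simpa [mul_comm] using this

/-- The moments of the standard normal law. -/
noncomputable def gaussMoment (n : ℕ) : ℝ := ∫ x, x ^ n ∂stdGauss

lemma gaussMoment_zero : gaussMoment 0 = 1 := by simp [gaussMoment]

lemma gaussMoment_one : gaussMoment 1 = 0 := by
  simp [gaussMoment]

lemma gaussMoment_add_two (n : ℕ) : gaussMoment (n + 2) = (n + 1) * gaussMoment n := by
  have := integral_X_mul_stdGauss (X ^ (n + 1))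
  simp only [eval_mul, eval_X, eval_pow, derivative_X_pow, eval_C,
    integral_const_mul, Nat.add_sub_cancel] at this
  rw [gaussMoment, gaussMoment]
  push_cast at this
  rw [← this]
  congr 1; ext x; ring

lemma gaussMoment_odd (n : ℕ) : gaussMoment (2 * n + 1) = 0 := by
  induction n with
  | zero => exact gaussMoment_one
  | succ n ih => rw [show 2 * (n + 1) + 1 = 2 * n + 1 + 2 by ring, gaussMoment_add_two, ih, mul_zero]

lemma gaussMoment_even_succ (n : ℕ) :
    gaussMoment (2 * (n + 1)) = (2 * n + 1) * gaussMoment (2 * n) := by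
  rw [show 2 * (n + 1) = 2 * n + 2 by ring, gaussMoment_add_two]; push_cast; ring

lemma gaussMoment_even_pos (n : ℕ) : 0 < gaussMoment (2 * n) := by
  induction n with
  | zero => simp [gaussMoment_zero]
  | succ n ih => rw [gaussMoment_even_succ]; positivity

lemma gaussMoment_even_mono : Monotone fun n => gaussMoment (2 * n) := by
  refine monotone_nat_of_le_succ fun n => ?_
  rw [gaussMoment_even_succ]
  nlinarith [gaussMoment_even_pos n, (Nat.cast_nonneg n : (0 : ℝ) ≤ n)]

/-- For odd `j` the numerator is eventually an odd moment, hence zero. For even `j > 0` the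
recursion for even moments makes the ratio at most `1 / K`. -/
lemma tendsto_gaussMoment_div (j : ℕ) :
    Tendsto (fun K => gaussMoment (2 * K - j) / gaussMoment (2 * K)) atTop
      (𝓝 (if j = 0 then 1 else 0)) := by
  rcases Nat.even_or_odd' j with ⟨l, rfl | rfl⟩
  · rcases Nat.eq_zero_or_pos l with rfl | hl
    · simp only [mul_zero, Nat.sub_zero, if_true]
      refine tendsto_const_nhds.congr fun K => ?_
      rw [div_self (gaussMoment_even_pos K).ne']
    · rw [if_neg (by omega)]
      have hlim : Tendsto (fun K : ℕ => 1 / ((K : ℝ))) atTop (𝓝 0) :=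
        tendsto_one_div_atTop_nhds_zero_nat
      refine tendsto_of_tendsto_of_tendsto_of_le_of_le' tendsto_const_nhds hlim ?_ ?_
      · refine Eventually.of_forall fun K => ?_
        rw [← Nat.mul_sub]
        exact (div_pos (gaussMoment_even_pos _) (gaussMoment_even_pos _)).le
      · filter_upwards [eventually_ge_atTop 1] with K hK
        rw [← Nat.mul_sub, div_le_div_iff₀ (gaussMoment_even_pos _) (by exact_mod_cast hK)]
        obtain ⟨M, rfl⟩ := Nat.exists_eq_add_of_le' hK
        have h1 : gaussMoment (2 * (M + 1 - l)) ≤ gaussMoment (2 * M) :=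
          gaussMoment_even_mono (by omega)
        rw [gaussMoment_even_succ]
        have := gaussMoment_even_pos M
        push_cast
        nlinarith [(Nat.cast_nonneg M : (0 : ℝ) ≤ M)]
  · rw [if_neg (by omega)]
    refine tendsto_const_nhds.congr' ?_
    filter_upwards [eventually_ge_atTop (l + 1)] with K hK
    rw [show 2 * K - (2 * l + 1) = 2 * (K - l - 1) + 1 by omega, gaussMoment_odd, zero_div]

/-- Integration against a high power reads off the coefficient of `x ^ n`: lower monomials
contribute moments of order below `2K`, which are negligible after normalization. -/
lemma tendsto_integral_pow_mul_div {n : ℕ} {p : Polynomial ℝ} (hp : p.natDegree ≤ n) :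
    Tendsto (fun K => (∫ x, x ^ (2 * K - n) * p.eval x ∂stdGauss) / gaussMoment (2 * K)) atTop
      (𝓝 (p.coeff n)) := by
  have h : ∀ᶠ K in atTop, ∑ i ∈ Finset.range (n + 1), p.coeff i *
      (gaussMoment (2 * K - (n - i)) / gaussMoment (2 * K)) =
      (∫ x, x ^ (2 * K - n) * p.eval x ∂stdGauss) / gaussMoment (2 * K) := by
    -- From `n ≤ K` on, the truncated subtraction `2 * K - n` is a true one.
    filter_upwards [eventually_ge_atTop n] with K hK
    have (x : ℝ) : x ^ (2 * K - n) * p.eval x =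
        ∑ i ∈ Finset.range (n + 1), p.coeff i * x ^ (2 * K - (n - i)) := by
      rw [eval_eq_sum_range' (Nat.lt_succ_of_le hp), Finset.mul_sum]
      refine Finset.sum_congr rfl fun i hi => ?_
      rw [Finset.mem_range] at hi
      rw [show 2 * K - (n - i) = (2 * K - n) + i by omega, pow_add]; ring
    simp only [this]
    rw [integral_finsetSum _ fun i _ => ?_, Finset.sum_div]
    · refine Finset.sum_congr rfl fun i _ => ?_
      rw [integral_const_mul, gaussMoment, mul_div_assoc]
    · simpa using (integrable_eval_stdGauss (X ^ (2 * K - (n - i)))).const_mul (p.coeff i)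
  refine Tendsto.congr' h ?_
  have : p.coeff n = ∑ i ∈ Finset.range (n + 1), p.coeff i * (if n - i = 0 then 1 else 0) := by
    rw [Finset.sum_eq_single n]
    · simp
    · intro i hi hin
      rw [Finset.mem_range] at hi
      rw [if_neg (by omega), mul_zero]
    · simp
  rw [this]
  exact tendsto_finsetSum _ fun i _ => (tendsto_gaussMoment_div (n - i)).const_mul _

/-- The Ornstein-Uhlenbeck semigroup acts diagonally on the Hermite polynomials. -/
lemma integral_herm_add {c s : ℝ} (h : c ^ 2 + s ^ 2 = 1) (n : ℕ) (a : ℝ) :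
    ∫ w, (herm n).eval (c * a + s * w) ∂stdGauss = c ^ n * (herm n).eval a := by
  have key (p : Polynomial ℝ) (w : ℝ) :
      p.eval (c * a + s * w) = (p.comp (C (c * a) + C s * X)).eval w := by simp
  have hI (p : Polynomial ℝ) : Integrable (fun w => p.eval (c * a + s * w)) stdGauss := by
    simp only [key]; exact integrable_eval_stdGauss _
  -- Integration by parts along the affine substitution; the chain rule supplies the factor `s`.
  have hstein (p : Polynomial ℝ) : ∫ w, w * p.eval (c * a + s * w) ∂stdGauss =
      s * ∫ w, (derivative p).eval (c * a + s * w) ∂stdGauss := by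
    have := integral_X_mul_stdGauss (p.comp (C (c * a) + C s * X))
    rw [derivative_comp] at this
    simp only [eval_mul, eval_X, ← key] at this
    rw [this, ← integral_const_mul]
    congr 1; ext w; simp
  have hI' (p : Polynomial ℝ) : Integrable (fun w => w * p.eval (c * a + s * w)) stdGauss := by
    have := integrable_eval_stdGauss (X * p.comp (C (c * a) + C s * X))
    simpa only [eval_mul, eval_X, ← key] using this
  induction n using Nat.strong_induction_on with
  | _ n ih =>
    match n with
    | 0 => simp [herm_zero]
    | 1 =>
      have h2 := hstein 1
      simp only [eval_one, mul_one, derivative_one, eval_zero, integral_zero, mul_zero] at h2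
      simp only [herm_one, eval_X, pow_one]
      rw [integral_add (integrable_const _), integral_const_mul s, h2]
      · simp
      · simpa using (integrable_eval_stdGauss X).const_mul s
    | n + 2 =>
      have e (w : ℝ) : (herm (n + 2)).eval (c * a + s * w) =
          c * a * (herm (n + 1)).eval (c * a + s * w) +
          (s * (w * (herm (n + 1)).eval (c * a + s * w)) -
            (n + 1) * (herm n).eval (c * a + s * w)) := by
        have := congrArg (eval (c * a + s * w)) (X_mul_herm_succ n)
        simp only [eval_mul, eval_X, eval_add, eval_C] at this
        rw [eq_sub_of_add_eq this.symm]; ring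
      simp only [e]
      have i1 := (hI (herm (n + 1))).const_mul (c * a)
      have i2 := (hI' (herm (n + 1))).const_mul s
      have i3 := (hI (herm n)).const_mul (n + 1 : ℝ)
      have i4 : Integrable (fun w => s * (w * (herm (n + 1)).eval (c * a + s * w)) -
        (n + 1 : ℝ) * (herm n).eval (c * a + s * w)) stdGauss := i2.sub i3
      rw [integral_add i1 i4, integral_sub i2 i3, integral_const_mul,
        integral_const_mul, integral_const_mul, hstein, derivative_herm_succ]
      simp only [eval_mul, eval_C, integral_const_mul]
      rw [ih n (by omega), ih (n + 1) (by omega)]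
      have := congrArg (eval a) (X_mul_herm_succ n)
      simp only [eval_mul, eval_X, eval_add, eval_C] at this
      rw [eq_sub_of_add_eq this.symm]
      -- The recurrence leaves `(n + 1) (s² - 1) cⁿ H_n(a)`, and `s² - 1 = -c²` makes this the lower
      -- term of `cⁿ⁺² H_{n+2}(a)`.
      have hs : s ^ 2 = 1 - c ^ 2 := by linarith
      linear_combination (n + 1) * c ^ n * (herm n).eval a * hs

end GaussianMoments

/-! ### The algebra of functions with moments of all orders. -/

section AllMoments

variable {Ω : Type*} [MeasurableSpace Ω] {μ : Measure Ω}

/-- The function `f` lies in all the spaces `Lᵖ(μ)`, `p < ∞`. -/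
def HasAllMoments (μ : Measure Ω) (f : Ω → ℝ) : Prop :=
  ∀ p : ENNReal, p ≠ ⊤ → MemLp f p μ

lemma HasAllMoments.integrable {f : Ω → ℝ} (hf : HasAllMoments μ f) : Integrable f μ :=
  memLp_one_iff_integrable.1 (hf 1 ENNReal.one_ne_top)

lemma HasAllMoments.memLp_two {f : Ω → ℝ} (hf : HasAllMoments μ f) : MemLp f 2 μ :=
  hf 2 ENNReal.ofNat_ne_top

lemma HasAllMoments.const [IsFiniteMeasure μ] (c : ℝ) : HasAllMoments μ fun _ => c :=
  fun _ _ => memLp_const c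

lemma HasAllMoments.add {f g : Ω → ℝ} (hf : HasAllMoments μ f) (hg : HasAllMoments μ g) :
    HasAllMoments μ fun x => f x + g x :=
  fun p hp => (hf p hp).add (hg p hp)

lemma HasAllMoments.mul {f g : Ω → ℝ} (hf : HasAllMoments μ f) (hg : HasAllMoments μ g) :
    HasAllMoments μ fun x => f x * g x := by
  intro p hp
  have h2 : (2 * p : ENNReal) ≠ ⊤ := ENNReal.mul_ne_top ENNReal.ofNat_ne_top hp
  have : ENNReal.HolderTriple (2 * p) (2 * p) p := ⟨by
    rw [ENNReal.mul_inv (Or.inl two_ne_zero) (Or.inl ENNReal.ofNat_ne_top), ← add_mul,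
      ENNReal.inv_two_add_inv_two, one_mul]⟩
  exact (hg _ h2).mul (hf _ h2)

lemma HasAllMoments.pow [IsFiniteMeasure μ] {f : Ω → ℝ} (hf : HasAllMoments μ f) (n : ℕ) :
    HasAllMoments μ fun x => f x ^ n := by
  induction n with
  | zero => simpa using HasAllMoments.const 1
  | succ n ih => simpa only [pow_succ] using ih.mul hf

lemma HasAllMoments.prod [IsFiniteMeasure μ] {ι : Type*} (s : Finset ι) {f : ι → Ω → ℝ}
    (hf : ∀ i, HasAllMoments μ (f i)) : HasAllMoments μ fun x => ∏ i ∈ s, f i x := by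
  classical
  induction s using Finset.induction_on with
  | empty => simpa using HasAllMoments.const 1
  | insert i s hi ih => simpa only [Finset.prod_insert hi] using (hf i).mul ih

lemma HasAllMoments.sum [IsFiniteMeasure μ] {ι : Type*} (s : Finset ι) {f : ι → Ω → ℝ}
    (hf : ∀ i, HasAllMoments μ (f i)) : HasAllMoments μ fun x => ∑ i ∈ s, f i x := by
  classical
  induction s using Finset.induction_on with
  | empty => simpa using HasAllMoments.const 0
  | insert i s hi ih => simpa only [Finset.sum_insert hi] using (hf i).add ih

lemma HasAllMoments.polynomial [IsFiniteMeasure μ] {f : Ω → ℝ} (hf : HasAllMoments μ f)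
    (p : Polynomial ℝ) : HasAllMoments μ fun x => p.eval (f x) := by
  simp only [Polynomial.eval_eq_sum_range]
  exact HasAllMoments.sum _ fun i => (HasAllMoments.const _).mul (hf.pow i)

lemma HasAllMoments.mvPolynomial [IsFiniteMeasure μ] {σ : Type*} {f : Ω → σ → ℝ}
    (hf : ∀ i, HasAllMoments μ fun x => f x i) (q : MvPolynomial σ ℝ) :
    HasAllMoments μ fun x => MvPolynomial.eval (f x) q := by
  simp only [MvPolynomial.eval_eq]
  exact HasAllMoments.sum _ fun i => (HasAllMoments.const _).mul
    (HasAllMoments.prod _ fun j => (hf j).pow _)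

end AllMoments

/-! ### Measures with exponential moments are determined by their moments. -/

section Determinacy

variable {E F : Type*} [NormedAddCommGroup E] [NormedSpace ℝ E] [MeasurableSpace E] [BorelSpace E]
  [NormedAddCommGroup F] [NormedSpace ℝ F] [MeasurableSpace F] [BorelSpace F]

/-- All continuous linear functionals have exponential moments of all orders under `μ`. -/
def HasExpMoments (μ : Measure E) : Prop :=
  ∀ L : StrongDual ℝ E, Integrable (fun z => Real.exp |L z|) μ

/-- The exponential series of `i L` may be integrated term by term, since its terms are dominated by
those of `exp |L|`. The characteristic function is thus a function of the moments. -/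
lemma HasExpMoments.hasSum_charFunDual {μ : Measure E}
    (hμ : HasExpMoments μ) (L : StrongDual ℝ E) :
    HasSum (fun k : ℕ => ((Complex.I ^ k / k.factorial : ℂ)) * ((∫ z, L z ^ k ∂μ : ℝ) : ℂ))
      (charFunDual μ L) := by
  rw [charFunDual_apply]
  have hs (z : E) : HasSum (fun k : ℕ => |L z| ^ k / k.factorial) (Real.exp |L z|) := by
    rw [Real.exp_eq_exp_ℝ]; exact NormedSpace.expSeries_div_hasSum_exp _
  have := hasSum_integral_of_dominated_convergence
    (F := fun (k : ℕ) z => (Complex.I ^ k / k.factorial : ℂ) * ((L z ^ k : ℝ) : ℂ))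
    (f := fun z => Complex.exp (L z * Complex.I)) (μ := μ)
    (fun (k : ℕ) z => |L z| ^ k / k.factorial)
    (fun k => by fun_prop)
    (fun k => ae_of_all _ fun z => by simp [div_mul_eq_mul_div])
    (ae_of_all _ fun z => (hs z).summable)
    (by simpa only [(hs _).tsum_eq] using hμ L)
    (ae_of_all _ fun z => by
      rw [Complex.exp_eq_exp_ℂ]
      have h := NormedSpace.expSeries_div_hasSum_exp ((L z : ℂ) * Complex.I)
      have e : (fun k : ℕ => (Complex.I ^ k / k.factorial : ℂ) * ((L z ^ k : ℝ) : ℂ)) =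
          fun k : ℕ => ((L z : ℂ) * Complex.I) ^ k / k.factorial := by
        ext k; rw [mul_pow]; push_cast; ring
      rw [← e] at h
      exact h)
  simpa only [integral_const_mul, integral_complex_ofReal] using this

/-- A finite measure with exponential moments is determined by its polynomial moments. -/
lemma ext_of_moments [CompleteSpace E] [SecondCountableTopology E] {μ ν : Measure E}
    [IsFiniteMeasure μ] [IsFiniteMeasure ν] (hμ : HasExpMoments μ) (hν : HasExpMoments ν)
    (h : ∀ (L : StrongDual ℝ E) (k : ℕ), ∫ z, L z ^ k ∂μ = ∫ z, L z ^ k ∂ν) : μ = ν := by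
  refine Measure.ext_of_charFunDual ?_
  ext L
  refine (hμ.hasSum_charFunDual L).unique ?_
  simpa only [h] using hν.hasSum_charFunDual L

lemma IsGaussian.hasExpMoments (μ : Measure E) [IsGaussian μ] : HasExpMoments μ := by
  intro L
  have h := IsGaussian.map_eq_gaussianReal (μ := μ) L
  have h1 (t : ℝ) : Integrable (fun z => Real.exp (t * L z)) μ := by
    have := integrable_exp_mul_gaussianReal (μ := μ[L]) (v := Var[L; μ].toNNReal) t
    rw [← h] at this
    exact this.comp_measurable (by fun_prop)
  simpa using integrable_exp_mul_abs (h1 1) (h1 (-1))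

/-- The bound `exp |s + t| ≤ exp (2|s|) + exp (2|t|)` needs no independence, so every coupling of
normal marginals is covered. -/
lemma HasExpMoments.of_marginals [SecondCountableTopology E] [SecondCountableTopology F]
    {μ : Measure (E × F)} (h1 : HasExpMoments μ.fst) (h2 : HasExpMoments μ.snd) : HasExpMoments μ := by
  intro L
  let L1 : StrongDual ℝ E := L.comp (.inl ℝ E F)
  let L2 : StrongDual ℝ F := L.comp (.inr ℝ E F)
  have e (z : E × F) : L z = L1 z.1 + L2 z.2 := by
    simp [L1, L2, ← map_add]
  have i1 := (h1 ((2 : ℝ) • L1)).comp_measurable measurable_fst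
  have i2 := (h2 ((2 : ℝ) • L2)).comp_measurable measurable_snd
  refine (i1.add i2).mono' (by fun_prop) (ae_of_all _ fun z => ?_)
  simp only [Real.norm_eq_abs, Real.abs_exp, Pi.add_apply, Function.comp_apply, smul_apply,
    smul_eq_mul, abs_mul, abs_two, e]
  have h := abs_add_le (L1 z.1) (L2 z.2)
  rcases le_total |L1 z.1| |L2 z.2| with h' | h'
  · have : Real.exp |L1 z.1 + L2 z.2| ≤ Real.exp (2 * |L2 z.2|) := Real.exp_le_exp.2 (by linarith)
    linarith [Real.exp_pos (2 * |L1 z.1|)]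
  · have : Real.exp |L1 z.1 + L2 z.2| ≤ Real.exp (2 * |L1 z.1|) := Real.exp_le_exp.2 (by linarith)
    linarith [Real.exp_pos (2 * |L2 z.2|)]

end Determinacy

/-! ### Normal laws are identified by means and covariances. -/

section GaussianVectors

/-- The characteristic function of a Gaussian law involves only the mean and variance of each
functional, and these are linear and bilinear in the spanning family `c`. -/
lemma gaussian_ext {E : Type*} [NormedAddCommGroup E] [NormedSpace ℝ E] [MeasurableSpace E]
    [BorelSpace E] [CompleteSpace E] [SecondCountableTopology E] {ι : Type*} [Fintype ι]
    (c : ι → StrongDual ℝ E) (hc : ∀ L : StrongDual ℝ E, ∃ r : ι → ℝ, ∀ z, L z = ∑ i, r i * c i z)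
    {μ ν : Measure E} [IsGaussian μ] [IsGaussian ν] (hmean : ∀ i, ∫ z, c i z ∂μ = ∫ z, c i z ∂ν)
    (hcov : ∀ i j, cov[c i, c j; μ] = cov[c i, c j; ν]) : μ = ν := by
  refine Measure.ext_of_charFunDual ?_
  ext L
  obtain ⟨r, hr⟩ := hc L
  have hL : (L : E → ℝ) = fun z => ∑ i, r i * c i z := funext hr
  have hm (ρ : Measure E) [IsGaussian ρ] : ∫ z, L z ∂ρ = ∑ i, r i * ∫ z, c i z ∂ρ := by
    rw [hL, integral_finsetSum _ fun i _ => (IsGaussian.integrable_dual ρ (c i)).const_mul _]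
    simp only [integral_const_mul]
  have hv (ρ : Measure E) [IsGaussian ρ] :
      Var[L; ρ] = ∑ i, ∑ j, r i * (r j * cov[c i, c j; ρ]) := by
    have h2 (i : ι) : MemLp (fun z => r i * c i z) 2 ρ :=
      (IsGaussian.memLp_dual ρ (c i) 2 (by simp)).const_mul _
    rw [← covariance_self (by fun_prop), hL, covariance_fun_sum_fun_sum h2 h2]
    simp only [covariance_const_mul_left, covariance_const_mul_right, mul_left_comm]
  rw [IsGaussian.charFunDual_eq, IsGaussian.charFunDual_eq, hv, hv,
    integral_complex_ofReal, integral_complex_ofReal, hm, hm]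
  simp only [hmean, hcov]

variable {d : ℕ}

instance normalLaw_isProbabilityMeasure (τ : Fin d → ℝ) : IsProbabilityMeasure (normalLaw τ) := by
  unfold normalLaw; infer_instance

lemma normalLaw_map_eval (τ : Fin d → ℝ) (i : Fin d) :
    (normalLaw τ).map (fun x => x i) = gaussianReal 0 (τ i).toNNReal :=
  (measurePreserving_eval (fun i => gaussianReal 0 (τ i).toNNReal) i).map_eq

lemma normalLaw_iIndepFun (τ : Fin d → ℝ) :
    iIndepFun (fun (i : Fin d) (x : Fin d → ℝ) => x i) (normalLaw τ) :=
  iIndepFun_pi (X := fun _ x => x) fun _ => aemeasurable_id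

instance normalLaw_isGaussian (τ : Fin d → ℝ) : IsGaussian (normalLaw τ) := by
  have : HasGaussianLaw (fun (x : Fin d → ℝ) (i : Fin d) => x i) (normalLaw τ) :=
    iIndepFun.hasGaussianLaw (fun i => ⟨by rw [normalLaw_map_eval]; infer_instance⟩)
      (normalLaw_iIndepFun τ)
  simpa using this.isGaussian_map

lemma normalLaw_memLp_eval (τ : Fin d → ℝ) (i : Fin d) :
    MemLp (fun x : Fin d → ℝ => x i) 2 (normalLaw τ) :=
  IsGaussian.memLp_dual (normalLaw τ) (ContinuousLinearMap.proj i) 2 (by simp)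

lemma normalLaw_mean (τ : Fin d → ℝ) (i : Fin d) : ∫ x, x i ∂normalLaw τ = 0 := by
  rw [← integral_map (φ := fun x : Fin d → ℝ => x i) (f := fun y => y)
    (measurable_pi_apply i).aemeasurable aestronglyMeasurable_id,
    normalLaw_map_eval, integral_id_gaussianReal]

lemma normalLaw_cov {τ : Fin d → ℝ} (hτ : ∀ i, 0 ≤ τ i) (i j : Fin d) :
    cov[fun x => x i, fun x => x j; normalLaw τ] = if i = j then τ i else 0 := by
  split_ifs with h
  · subst h
    rw [covariance_self (measurable_pi_apply i).aemeasurable]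
    have := variance_map (μ := normalLaw τ) (X := fun y : ℝ => y) (Y := fun x : Fin d → ℝ => x i)
      aemeasurable_id (measurable_pi_apply i).aemeasurable
    rw [normalLaw_map_eval, variance_fun_id_gaussianReal] at this
    simp only [Function.comp_def] at this
    rw [← this, Real.coe_toNNReal _ (hτ i)]
  · exact ((normalLaw_iIndepFun τ).indepFun h).covariance_eq_zero (normalLaw_memLp_eval τ i)
      (normalLaw_memLp_eval τ j)

lemma dual_pi_apply (L : StrongDual ℝ (Fin d → ℝ)) (x : Fin d → ℝ) :
    L x = ∑ i, L (Pi.single i 1) * x i := by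
  conv_lhs => rw [pi_eq_sum_univ' x]
  simp [map_sum, mul_comm]

lemma dual_prod_apply (L : StrongDual ℝ ((Fin d → ℝ) × (Fin d → ℝ)))
    (z : (Fin d → ℝ) × (Fin d → ℝ)) :
    L z = ∑ i, L (Pi.single i 1, 0) * z.1 i + ∑ i, L (0, Pi.single i 1) * z.2 i := by
  have h1 := dual_pi_apply (L.comp (.inl ℝ (Fin d → ℝ) (Fin d → ℝ))) z.1
  have h2 := dual_pi_apply (L.comp (.inr ℝ (Fin d → ℝ) (Fin d → ℝ))) z.2
  simp only [ContinuousLinearMap.comp_apply, ContinuousLinearMap.inl_apply,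
    ContinuousLinearMap.inr_apply] at h1 h2
  rw [← h1, ← h2, ← map_add]
  simp

lemma gaussian_eq_normalLaw {τ : Fin d → ℝ} (hτ : ∀ i, 0 ≤ τ i) {μ : Measure (Fin d → ℝ)}
    [IsGaussian μ] (hmean : ∀ i, ∫ x, x i ∂μ = 0)
    (hcov : ∀ i j, cov[fun x => x i, fun x => x j; μ] = if i = j then τ i else 0) :
    μ = normalLaw τ :=
  gaussian_ext (fun i => ContinuousLinearMap.proj i)
    (fun L => ⟨fun i => L (Pi.single i 1), dual_pi_apply L⟩)
    (fun i => (hmean i).trans (normalLaw_mean τ i).symm)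
    (fun i j => (hcov i j).trans (normalLaw_cov hτ i j).symm)

/-- This allows the unspecified kernel of `IsConditionallyNormal` to be replaced by the explicit
`pairLaw`. -/
lemma IsNormalPair.unique {τ : Fin d → ℝ} {V : Matrix (Fin d) (Fin d) ℝ}
    {μ ν : Measure ((Fin d → ℝ) × (Fin d → ℝ))} (hμ : IsNormalPair τ V μ)
    (hν : IsNormalPair τ V ν) : μ = ν := by
  have := hμ.isGaussian
  have := hν.isGaussian
  refine gaussian_ext (ι := Fin d ⊕ Fin d)
    (Sum.elim (fun i => (ContinuousLinearMap.proj i).comp (.fst ℝ _ _))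
      (fun i => (ContinuousLinearMap.proj i).comp (.snd ℝ _ _)))
    (fun L => ⟨Sum.elim (fun i => L (Pi.single i 1, 0)) (fun i => L (0, Pi.single i 1)), fun z => ?_⟩)
    ?_ ?_
  · rw [dual_prod_apply]; simp
  · rintro (i | i)
    · exact (hμ.mean_fst i).trans (hν.mean_fst i).symm
    · exact (hμ.mean_snd i).trans (hν.mean_snd i).symm
  · rintro (i | i) (j | j)
    · exact (hμ.cov_fst i j).trans (hν.cov_fst i j).symm
    · exact (hμ.cov_cross i j).trans (hν.cov_cross i j).symm
    · rw [covariance_comm, covariance_comm (μ := ν)]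
      exact (hμ.cov_cross j i).trans (hν.cov_cross j i).symm
    · exact (hμ.cov_snd i j).trans (hν.cov_snd i j).symm

lemma IsNormalPair.fst_eq {τ : Fin d → ℝ} (hτ : ∀ i, 0 ≤ τ i) {V : Matrix (Fin d) (Fin d) ℝ}
    {μ : Measure ((Fin d → ℝ) × (Fin d → ℝ))} (hμ : IsNormalPair τ V μ) :
    μ.fst = normalLaw τ := by
  have := hμ.isGaussian
  have : IsGaussian μ.fst := isGaussian_map (μ := μ) (.fst ℝ (Fin d → ℝ) (Fin d → ℝ))
  refine gaussian_eq_normalLaw hτ (fun i => ?_) fun i j => ?_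
  · exact (integral_map measurable_fst.aemeasurable (f := fun x : Fin d → ℝ => x i)
      (measurable_pi_apply i).aestronglyMeasurable).trans (hμ.mean_fst i)
  · rw [Measure.fst, covariance_map_fun (measurable_pi_apply i).aestronglyMeasurable
      (measurable_pi_apply j).aestronglyMeasurable (by fun_prop)]
    exact hμ.cov_fst i j

lemma IsNormalPair.snd_eq {τ : Fin d → ℝ} (hτ : ∀ i, 0 ≤ τ i) {V : Matrix (Fin d) (Fin d) ℝ}
    {μ : Measure ((Fin d → ℝ) × (Fin d → ℝ))} (hμ : IsNormalPair τ V μ) :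
    μ.snd = normalLaw τ := by
  have := hμ.isGaussian
  have : IsGaussian μ.snd := isGaussian_map (μ := μ) (.snd ℝ (Fin d → ℝ) (Fin d → ℝ))
  refine gaussian_eq_normalLaw hτ (fun i => ?_) fun i j => ?_
  · exact (integral_map measurable_snd.aemeasurable (f := fun x : Fin d → ℝ => x i)
      (measurable_pi_apply i).aestronglyMeasurable).trans (hμ.mean_snd i)
  · rw [Measure.snd, covariance_map_fun (measurable_pi_apply i).aestronglyMeasurable
      (measurable_pi_apply j).aestronglyMeasurable (by fun_prop)]
    exact hμ.cov_snd i j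

end GaussianVectors

/-! ### Linear change of variables to standard normal coordinates. -/

section Whitening

variable {d : ℕ}

/-- The linear map with matrix `c`. -/
noncomputable def linComb (c : Fin d → Fin d → ℝ) : (Fin d → ℝ) →L[ℝ] (Fin d → ℝ) :=
  ContinuousLinearMap.pi fun i => ∑ j, c i j • ContinuousLinearMap.proj j

@[simp]
lemma linComb_apply (c : Fin d → Fin d → ℝ) (w : Fin d → ℝ) (i : Fin d) :
    linComb c w i = ∑ j, c i j * w j := by
  simp [linComb]

/-- The standard deviations of the linear forms `x̂_j`. -/
noncomputable def scale (τ a : Fin d → ℝ) (j : Fin d) : ℝ := √(total τ * a j)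

/-- The linear map taking the normal law with variances `τ` to the standard normal law. -/
noncomputable def whiten (τ : Fin d → ℝ) (u : Fin d → Fin d → ℝ) (a : Fin d → ℝ) :
    (Fin d → ℝ) →L[ℝ] (Fin d → ℝ) :=
  linComb fun j i => u j i / scale τ a j

/-- The inverse of `whiten`. -/
noncomputable def unwhiten (τ : Fin d → ℝ) (u : Fin d → Fin d → ℝ) (a : Fin d → ℝ) :
    (Fin d → ℝ) →L[ℝ] (Fin d → ℝ) :=
  linComb fun i j => prob τ i * (u j i * (scale τ a j / a j))

lemma whiten_apply (τ : Fin d → ℝ) (u : Fin d → Fin d → ℝ) (a : Fin d → ℝ) (x : Fin d → ℝ)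
    (j : Fin d) : whiten τ u a x j = hat u x j / scale τ a j := by
  simp [whiten, hat, Finset.sum_div, div_mul_eq_mul_div]

variable [NeZero d] {τ : Fin d → ℝ} {u : Fin d → Fin d → ℝ} {a : Fin d → ℝ}

lemma total_pos (hτ : ∀ i, 0 < τ i) : 0 < total τ :=
  Finset.sum_pos (fun i _ => hτ i) ⟨0, Finset.mem_univ _⟩

lemma prob_pos (hτ : ∀ i, 0 < τ i) (i : Fin d) : 0 < prob τ i :=
  div_pos (hτ i) (total_pos hτ)

lemma IsOrthogonalBasis.norm_pos (hτ : ∀ i, 0 < τ i) (hu : IsOrthogonalBasis (prob τ) u a)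
    (k : Fin d) : 0 < a k := by
  have h := hu.orthogonal k k
  rw [if_pos rfl] at h
  rw [← h]
  obtain ⟨j, hj⟩ : ∃ j, u k j ≠ 0 := by
    by_contra! hc
    exact hu.complete.ne_zero k (funext hc)
  exact Finset.sum_pos' (fun i _ => mul_nonneg (mul_self_nonneg _) (prob_pos hτ i).le)
    ⟨j, Finset.mem_univ _, mul_pos (mul_self_pos.2 hj) (prob_pos hτ j)⟩

lemma scale_pos (hτ : ∀ i, 0 < τ i) (hu : IsOrthogonalBasis (prob τ) u a) (k : Fin d) :
    0 < scale τ a k :=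
  Real.sqrt_pos.2 (mul_pos (total_pos hτ) (hu.norm_pos hτ k))

lemma scale_sq (hτ : ∀ i, 0 < τ i) (hu : IsOrthogonalBasis (prob τ) u a) (k : Fin d) :
    scale τ a k ^ 2 = total τ * a k :=
  Real.sq_sqrt (mul_pos (total_pos hτ) (hu.norm_pos hτ k)).le

/-- The dual orthogonality relations. -/
lemma IsOrthogonalBasis.dual (hτ : ∀ i, 0 < τ i) (hu : IsOrthogonalBasis (prob τ) u a)
    (i k : Fin d) : ∑ j, u j i * u j k / a j * prob τ k = if i = k then 1 else 0 := by
  -- Orthogonality says that one square matrix is a left inverse of another. The dual relations say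
  -- that it is also a right inverse.
  have h : (Matrix.of fun (k j : Fin d) => u k j * prob τ j) *
      (Matrix.of fun (j l : Fin d) => u l j / a l) = 1 := by
    ext k l
    rw [Matrix.mul_apply, Matrix.one_apply]
    simp only [Matrix.of_apply]
    have := hu.orthogonal k l
    have hal := (hu.norm_pos hτ l).ne'
    calc _ = (∑ j, u k j * u l j * prob τ j) / a l := by
          rw [Finset.sum_div]; exact Finset.sum_congr rfl fun j _ => by ring
      _ = _ := by
          rw [this]
          split_ifs with hkl
          · rw [hkl, div_self hal]
          · simp
  have h' := mul_eq_one_comm.1 h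
  have h2 := congrFun (congrFun h' i) k
  rw [Matrix.mul_apply, Matrix.one_apply] at h2
  rw [← h2]
  exact Finset.sum_congr rfl fun j _ => by simp only [Matrix.of_apply]; ring

lemma whiten_unwhiten (hτ : ∀ i, 0 < τ i) (hu : IsOrthogonalBasis (prob τ) u a) (w : Fin d → ℝ) :
    whiten τ u a (unwhiten τ u a w) = w := by
  ext k
  simp only [whiten, unwhiten, linComb_apply, Finset.mul_sum]
  rw [Finset.sum_comm]
  have (l : Fin d) : ∑ j, u k j / scale τ a k * (prob τ j * (u l j * (scale τ a l / a l)) * w l) =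
      (scale τ a l / scale τ a k / a l * w l) * if k = l then a k else 0 := by
    rw [← hu.orthogonal k l, Finset.mul_sum]
    exact Finset.sum_congr rfl fun j _ => by ring
  simp only [this, mul_ite, mul_zero, Finset.sum_ite_eq, Finset.mem_univ, if_true]
  have h1 := (scale_pos hτ hu k).ne'
  have h2 := (hu.norm_pos hτ k).ne'
  field_simp

/-- A right inverse makes `whiten` surjective, and a surjective endomorphism of a finite-dimensional
space is injective. -/
lemma unwhiten_whiten (hτ : ∀ i, 0 < τ i) (hu : IsOrthogonalBasis (prob τ) u a) (x : Fin d → ℝ) :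
    unwhiten τ u a (whiten τ u a x) = x := by
  have hs : Function.Surjective (whiten τ u a).toLinearMap := fun w => ⟨_, whiten_unwhiten hτ hu w⟩
  exact LinearMap.injective_iff_surjective.2 hs (whiten_unwhiten hτ hu (whiten τ u a x))

end Whitening

/-! ### Normal pairs with prescribed correlations, and their kernel. -/

section Mehler

variable {d : ℕ}

/-- The standard normal law on `ℝᵈ`. -/
noncomputable abbrev stdLaw (d : ℕ) : Measure (Fin d → ℝ) := normalLaw fun _ => 1

lemma stdLaw_eq_pi : stdLaw d = Measure.pi fun _ => stdGauss := by
  simp [stdLaw, normalLaw, stdGauss]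

/-- The diagonal linear map. -/
noncomputable def diagMap (ξ : Fin d → ℝ) : (Fin d → ℝ) →L[ℝ] (Fin d → ℝ) :=
  ContinuousLinearMap.pi fun j => ξ j • ContinuousLinearMap.proj j

@[simp]
lemma diagMap_apply (ξ w : Fin d → ℝ) (j : Fin d) : diagMap ξ w j = ξ j * w j := by
  simp [diagMap]

/-- The linear map taking a pair of independent standard normal vectors to a pair of standard
normal vectors with correlations `ξ`. -/
noncomputable def mehlerMap (ξ : Fin d → ℝ) :
    (Fin d → ℝ) × (Fin d → ℝ) →L[ℝ] (Fin d → ℝ) × (Fin d → ℝ) :=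
  (ContinuousLinearMap.fst ℝ _ _).prod ((diagMap ξ).comp (ContinuousLinearMap.fst ℝ _ _) +
    (diagMap fun j => √(1 - ξ j ^ 2)).comp (ContinuousLinearMap.snd ℝ _ _))

@[simp]
lemma mehlerMap_fst (ξ : Fin d → ℝ) (z : (Fin d → ℝ) × (Fin d → ℝ)) :
    (mehlerMap ξ z).1 = z.1 := by
  simp [mehlerMap]

@[simp]
lemma mehlerMap_snd (ξ : Fin d → ℝ) (z : (Fin d → ℝ) × (Fin d → ℝ)) (j : Fin d) :
    (mehlerMap ξ z).2 j = ξ j * z.1 j + √(1 - ξ j ^ 2) * z.2 j := by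
  simp [mehlerMap]

/-- The law of a pair of standard normal vectors with correlations `ξ`. -/
noncomputable def mehlerLaw (ξ : Fin d → ℝ) : Measure ((Fin d → ℝ) × (Fin d → ℝ)) :=
  ((stdLaw d).prod (stdLaw d)).map (mehlerMap ξ)

instance (ξ : Fin d → ℝ) : IsGaussian (mehlerLaw ξ) := by
  unfold mehlerLaw; infer_instance

/-- The law of the normal pair with variances `τ` and cross covariances `crossCov τ u a ξ`. -/
noncomputable def pairLaw (τ : Fin d → ℝ) (u : Fin d → Fin d → ℝ) (a ξ : Fin d → ℝ) :
    Measure ((Fin d → ℝ) × (Fin d → ℝ)) :=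
  (mehlerLaw ξ).map ((unwhiten τ u a).prodMap (unwhiten τ u a))

instance (τ : Fin d → ℝ) (u : Fin d → Fin d → ℝ) (a ξ : Fin d → ℝ) :
    IsGaussian (pairLaw τ u a ξ) := by
  unfold pairLaw; infer_instance

/-- The laws `pairLaw τ u a ξ` as a kernel. -/
noncomputable def pairKernel (τ : Fin d → ℝ) (u : Fin d → Fin d → ℝ) (a : Fin d → ℝ) :
    Kernel (Fin d → ℝ) ((Fin d → ℝ) × (Fin d → ℝ)) :=
  (Kernel.id ×ₖ Kernel.const _ ((stdLaw d).prod (stdLaw d))).map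
    fun p => ((unwhiten τ u a).prodMap (unwhiten τ u a)) (mehlerMap p.1 p.2)

lemma measurable_pairKernel_map (τ : Fin d → ℝ) (u : Fin d → Fin d → ℝ) (a : Fin d → ℝ) :
    Measurable fun p : (Fin d → ℝ) × (Fin d → ℝ) × (Fin d → ℝ) =>
      ((unwhiten τ u a).prodMap (unwhiten τ u a)) (mehlerMap p.1 p.2) := by
  refine (ContinuousLinearMap.measurable _).comp ?_
  refine Measurable.prodMk (f := fun p : (Fin d → ℝ) × (Fin d → ℝ) × (Fin d → ℝ) =>
    (mehlerMap p.1 p.2).1) (g := fun p => (mehlerMap p.1 p.2).2) ?_ ?_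
  · simp only [mehlerMap_fst]; fun_prop
  · refine measurable_pi_lambda _ fun j => ?_
    simp only [mehlerMap_snd]; fun_prop

instance (τ : Fin d → ℝ) (u : Fin d → Fin d → ℝ) (a : Fin d → ℝ) :
    IsMarkovKernel (pairKernel τ u a) := by
  unfold pairKernel
  exact Kernel.IsMarkovKernel.map _ (measurable_pairKernel_map τ u a)

lemma pairKernel_apply (τ : Fin d → ℝ) (u : Fin d → Fin d → ℝ) (a ξ : Fin d → ℝ) :
    pairKernel τ u a ξ = pairLaw τ u a ξ := by
  rw [pairKernel, Kernel.map_apply _ (measurable_pairKernel_map τ u a), Kernel.prod_apply,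
    Kernel.id_apply, Kernel.const_apply, Measure.dirac_prod,
    Measure.map_map (measurable_pairKernel_map τ u a) (by fun_prop), pairLaw, mehlerLaw,
    Measure.map_map (by fun_prop) (by fun_prop)]
  rfl

/-- Bilinearity reduces everything to two independent standard vectors. The restriction `|ξ_j| ≤ 1`
is what makes `ξ_j² + √(1 - ξ_j²)² = 1`. -/
lemma mehlerLaw_cov_aux {ξ : Fin d → ℝ} (hξ : ∀ j, ξ j ∈ Set.Icc (-1 : ℝ) 1) (j l : Fin d) :
    cov[fun z => z.1 j, fun z => z.1 l; mehlerLaw ξ] = (if j = l then 1 else 0) ∧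
    cov[fun z => z.1 j, fun z => z.2 l; mehlerLaw ξ] = (if j = l then ξ j else 0) ∧
    cov[fun z => z.2 j, fun z => z.2 l; mehlerLaw ξ] = (if j = l then 1 else 0) := by
  set P := (stdLaw d).prod (stdLaw d) with hP
  have m1 (j : Fin d) : MemLp (fun z : (Fin d → ℝ) × (Fin d → ℝ) => z.1 j) 2 P :=
    IsGaussian.memLp_dual P ((ContinuousLinearMap.proj j).comp (.fst ℝ _ _)) 2 (by simp)
  have m2 (j : Fin d) : MemLp (fun z : (Fin d → ℝ) × (Fin d → ℝ) => z.2 j) 2 P :=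
    IsGaussian.memLp_dual P ((ContinuousLinearMap.proj j).comp (.snd ℝ _ _)) 2 (by simp)
  have e1 (j : Fin d) : Measurable (fun z : (Fin d → ℝ) × (Fin d → ℝ) => z.1 j) := by fun_prop
  have e2 (j : Fin d) : Measurable (fun z : (Fin d → ℝ) × (Fin d → ℝ) => z.2 j) := by fun_prop
  have c11 (j l : Fin d) : cov[fun z => z.1 j, fun z => z.1 l; P] = if j = l then 1 else 0 := by
    rw [← normalLaw_cov (τ := fun _ => 1) (fun _ => zero_le_one)]
    have := covariance_map_fun (μ := P) (Z := Prod.fst) (X := fun x => x j) (Y := fun x => x l)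
      (measurable_pi_apply j).aestronglyMeasurable
      (measurable_pi_apply l).aestronglyMeasurable (by fun_prop)
    rw [← this, hP, Measure.map_fst_prod, measure_univ, one_smul]
  have c22 (j l : Fin d) : cov[fun z => z.2 j, fun z => z.2 l; P] = if j = l then 1 else 0 := by
    rw [← normalLaw_cov (τ := fun _ => 1) (fun _ => zero_le_one)]
    have := covariance_map_fun (μ := P) (Z := Prod.snd) (X := fun x => x j) (Y := fun x => x l)
      (measurable_pi_apply j).aestronglyMeasurable
      (measurable_pi_apply l).aestronglyMeasurable (by fun_prop)
    rw [← this, hP, Measure.map_snd_prod, measure_univ, one_smul]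
  have c12 (j l : Fin d) : cov[fun z => z.1 j, fun z => z.2 l; P] = 0 :=
    covariance_fst_snd_prod (normalLaw_memLp_eval _ j) (normalLaw_memLp_eval _ l)
  have c21 (j l : Fin d) : cov[fun z => z.2 j, fun z => z.1 l; P] = 0 := by
    rw [covariance_comm, c12]
  have hm : AEMeasurable (mehlerMap ξ) P := by fun_prop
  refine ⟨?_, ?_, ?_⟩
  · rw [mehlerLaw, covariance_map_fun (e1 j).aestronglyMeasurable (e1 l).aestronglyMeasurable hm]
    simpa only [mehlerMap_fst] using c11 j l
  · rw [mehlerLaw, covariance_map_fun (e1 j).aestronglyMeasurable (e2 l).aestronglyMeasurable hm]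
    simp only [mehlerMap_fst, mehlerMap_snd]
    have := covariance_add_right (m1 j) ((m1 l).const_mul (ξ l))
      ((m2 l).const_mul (√(1 - ξ l ^ 2)))
    refine this.trans ?_
    rw [covariance_const_mul_right, covariance_const_mul_right, c11, c12]
    split_ifs with h <;> simp [h]
  · rw [mehlerLaw, covariance_map_fun (e2 j).aestronglyMeasurable (e2 l).aestronglyMeasurable hm]
    simp only [mehlerMap_snd]
    have h1 := covariance_add_left (Z := fun z : (Fin d → ℝ) × (Fin d → ℝ) =>
        ξ l * z.1 l + √(1 - ξ l ^ 2) * z.2 l) ((m1 j).const_mul (ξ j))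
      ((m2 j).const_mul (√(1 - ξ j ^ 2)))
      (((m1 l).const_mul (ξ l)).add ((m2 l).const_mul (√(1 - ξ l ^ 2))))
    refine h1.trans ?_
    have h2 := covariance_add_right ((m1 j).const_mul (ξ j)) ((m1 l).const_mul (ξ l))
      ((m2 l).const_mul (√(1 - ξ l ^ 2)))
    have h3 := covariance_add_right ((m2 j).const_mul (√(1 - ξ j ^ 2))) ((m1 l).const_mul (ξ l))
      ((m2 l).const_mul (√(1 - ξ l ^ 2)))
    refine (congrArg₂ (· + ·) h2 h3).trans ?_
    simp only [covariance_const_mul_right, covariance_const_mul_left, c11, c12, c21, c22]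
    split_ifs with h
    · subst h
      have hs : √(1 - ξ j ^ 2) ^ 2 = 1 - ξ j ^ 2 := by
        apply Real.sq_sqrt
        have := hξ j
        nlinarith [this.1, this.2]
      linear_combination hs
    · simp

lemma mehlerLaw_mean (ξ : Fin d → ℝ) (j : Fin d) :
    ∫ z, z.1 j ∂mehlerLaw ξ = 0 ∧ ∫ z, z.2 j ∂mehlerLaw ξ = 0 := by
  set P := (stdLaw d).prod (stdLaw d) with hP
  have i1 (j : Fin d) : Integrable (fun z : (Fin d → ℝ) × (Fin d → ℝ) => z.1 j) P :=
    IsGaussian.integrable_dual P ((ContinuousLinearMap.proj j).comp (.fst ℝ _ _))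
  have i2 (j : Fin d) : Integrable (fun z : (Fin d → ℝ) × (Fin d → ℝ) => z.2 j) P :=
    IsGaussian.integrable_dual P ((ContinuousLinearMap.proj j).comp (.snd ℝ _ _))
  have e1 (j : Fin d) : Measurable (fun z : (Fin d → ℝ) × (Fin d → ℝ) => z.1 j) := by fun_prop
  have e2 (j : Fin d) : Measurable (fun z : (Fin d → ℝ) × (Fin d → ℝ) => z.2 j) := by fun_prop
  have hm : AEMeasurable (mehlerMap ξ) P := by fun_prop
  have z1 : ∫ z, z.1 j ∂P = 0 :=
    (integral_fun_fst (fun x : Fin d → ℝ => x j)).trans (by simp [normalLaw_mean])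
  have z2 : ∫ z, z.2 j ∂P = 0 :=
    (integral_fun_snd (fun x : Fin d → ℝ => x j)).trans (by simp [normalLaw_mean])
  rw [mehlerLaw, integral_map hm (e1 j).aestronglyMeasurable,
    integral_map hm (e2 j).aestronglyMeasurable]
  simp only [mehlerMap_fst, mehlerMap_snd]
  refine ⟨z1, ?_⟩
  rw [integral_add ((i1 j).const_mul _) ((i2 j).const_mul _), integral_const_mul,
    integral_const_mul, z1, z2]
  simp

lemma isNormalPair_pairLaw [NeZero d] {τ : Fin d → ℝ} {u : Fin d → Fin d → ℝ} {a : Fin d → ℝ}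
    (hτ : ∀ i, 0 < τ i) (hu : IsOrthogonalBasis (prob τ) u a) {ξ : Fin d → ℝ}
    (hξ : ∀ j, ξ j ∈ Set.Icc (-1 : ℝ) 1) :
    IsNormalPair τ (crossCov τ u a ξ) (pairLaw τ u a ξ) := by
  set c : Fin d → Fin d → ℝ := fun i j => prob τ i * (u j i * (scale τ a j / a j)) with hc
  have hG1 (z : (Fin d → ℝ) × (Fin d → ℝ)) (i : Fin d) :
      ((unwhiten τ u a).prodMap (unwhiten τ u a) z).1 i = ∑ j, c i j * z.1 j :=
    linComb_apply c z.1 i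
  have hG2 (z : (Fin d → ℝ) × (Fin d → ℝ)) (i : Fin d) :
      ((unwhiten τ u a).prodMap (unwhiten τ u a) z).2 i = ∑ j, c i j * z.2 j :=
    linComb_apply c z.2 i
  have hm : AEMeasurable ((unwhiten τ u a).prodMap (unwhiten τ u a)) (mehlerLaw ξ) := by fun_prop
  have e1 (j : Fin d) : Measurable (fun z : (Fin d → ℝ) × (Fin d → ℝ) => z.1 j) := by fun_prop
  have e2 (j : Fin d) : Measurable (fun z : (Fin d → ℝ) × (Fin d → ℝ) => z.2 j) := by fun_prop
  have L1 (j : Fin d) : MemLp (fun z : (Fin d → ℝ) × (Fin d → ℝ) => z.1 j) 2 (mehlerLaw ξ) :=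
    IsGaussian.memLp_dual (mehlerLaw ξ) ((ContinuousLinearMap.proj j).comp (.fst ℝ _ _)) 2 (by simp)
  have L2 (j : Fin d) : MemLp (fun z : (Fin d → ℝ) × (Fin d → ℝ) => z.2 j) 2 (mehlerLaw ξ) :=
    IsGaussian.memLp_dual (mehlerLaw ξ) ((ContinuousLinearMap.proj j).comp (.snd ℝ _ _)) 2 (by simp)
  have hpt : total τ ≠ 0 := (total_pos hτ).ne'
  -- Unwhitening a diagonal covariance `r`. The weights `r = ξ` give `crossCov`, while `r = 1` gives
  -- the marginal covariance through the dual orthogonality relations.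
  have key (i k : Fin d) (r : Fin d → ℝ) :
      ∑ j, ∑ l, c i j * (c k l * if j = l then r j else 0) =
        total τ * prob τ i * prob τ k * ∑ l, r l * (a l)⁻¹ * u l i * u l k := by
    rw [Finset.mul_sum]
    refine Finset.sum_congr rfl fun j _ => ?_
    simp only [mul_ite, mul_zero, Finset.sum_ite_eq, Finset.mem_univ, if_true, hc]
    have h1 := scale_sq hτ hu j
    have h2 := (hu.norm_pos hτ j).ne'
    field_simp
    linear_combination prob τ i * u j i * prob τ k * u j k * r j * h1
  have key1 (i k : Fin d) : ∑ j, ∑ l, c i j * (c k l * if j = l then 1 else 0) =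
      if i = k then τ i else 0 := by
    rw [key i k fun _ => 1]
    have h := hu.dual hτ i k
    have h2 : ∑ l, 1 * (a l)⁻¹ * u l i * u l k * prob τ k = if i = k then 1 else 0 := by
      rw [← h]; exact Finset.sum_congr rfl fun j _ => by ring
    rw [← Finset.sum_mul] at h2
    have h3 : total τ * prob τ i = τ i := by rw [prob]; field_simp
    rw [h3]
    calc _ = τ i * ((∑ l, 1 * (a l)⁻¹ * u l i * u l k) * prob τ k) := by ring
      _ = _ := by rw [h2]; simp
  constructor
  · infer_instance
  · intro i
    rw [pairLaw, integral_map hm (e1 i).aestronglyMeasurable]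
    simp only [hG1]
    rw [integral_finsetSum _ fun j _ => ((L1 j).integrable one_le_two).const_mul _]
    simp [integral_const_mul, (mehlerLaw_mean ξ _).1]
  · intro i
    rw [pairLaw, integral_map hm (e2 i).aestronglyMeasurable]
    simp only [hG2]
    rw [integral_finsetSum _ fun j _ => ((L2 j).integrable one_le_two).const_mul _]
    simp [integral_const_mul, (mehlerLaw_mean ξ _).2]
  · intro i k
    rw [pairLaw, covariance_map_fun (e1 i).aestronglyMeasurable (e1 k).aestronglyMeasurable hm]
    simp only [hG1]
    rw [covariance_fun_sum_fun_sum (fun j => (L1 j).const_mul _) (fun j => (L1 j).const_mul _)]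
    simp only [covariance_const_mul_left, covariance_const_mul_right, (mehlerLaw_cov_aux hξ _ _).1]
    rw [← key1]
    simp only [mul_left_comm]
  · intro i k
    rw [pairLaw, covariance_map_fun (e2 i).aestronglyMeasurable (e2 k).aestronglyMeasurable hm]
    simp only [hG2]
    rw [covariance_fun_sum_fun_sum (fun j => (L2 j).const_mul _) (fun j => (L2 j).const_mul _)]
    simp only [covariance_const_mul_left, covariance_const_mul_right,
      (mehlerLaw_cov_aux hξ _ _).2.2]
    rw [← key1]
    simp only [mul_left_comm]
  · intro i k
    rw [pairLaw, covariance_map_fun (e1 i).aestronglyMeasurable (e2 k).aestronglyMeasurable hm]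
    simp only [hG1, hG2]
    rw [covariance_fun_sum_fun_sum (fun j => (L1 j).const_mul _) (fun j => (L2 j).const_mul _)]
    simp only [covariance_const_mul_left, covariance_const_mul_right,
      (mehlerLaw_cov_aux hξ _ _).2.1]
    rw [crossCov, Matrix.of_apply, ← key i k ξ]
    simp only [mul_left_comm]

end Mehler

/-! ### Products of Hermite polynomials under the standard normal law. -/

section HermiteProducts

variable {d : ℕ}

/-- The product Hermite polynomial of multi-degree `n` for the standard normal law. -/
noncomputable def herms (n : Fin d → ℕ) (w : Fin d → ℝ) : ℝ := ∏ j, (herm (n j)).eval (w j)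

/-- The product of factorials `n! = ∏ j, n_j!`, the squared norm of `herms n`. -/
noncomputable def multiFact (n : Fin d → ℕ) : ℝ := ∏ j, ((n j).factorial : ℝ)

lemma multiFact_pos (n : Fin d → ℕ) : 0 < multiFact n :=
  Finset.prod_pos fun j _ => by positivity

lemma herms_zero (w : Fin d → ℝ) : herms 0 w = 1 := by simp [herms, herm_zero]

@[fun_prop]
lemma continuous_herms (n : Fin d → ℕ) : Continuous (herms n) := by
  unfold herms; fun_prop

lemma integral_stdLaw_prod (f : Fin d → ℝ → ℝ) :
    ∫ w, ∏ j, f j (w j) ∂stdLaw d = ∏ j, ∫ x, f j x ∂stdGauss := by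
  rw [stdLaw_eq_pi, integral_fintype_prod_eq_prod]

lemma prod_ite_eq_funext {ι M : Type*} [Fintype ι] [DecidableEq ι] [CommMonoidWithZero M]
    {κ : Type*} [DecidableEq κ] (m n : ι → κ) (f : ι → M) :
    ∏ j, (if m j = n j then f j else 0) = if m = n then ∏ j, f j else 0 := by
  split_ifs with h
  · subst h; simp
  · obtain ⟨j, hj⟩ := Function.ne_iff.1 h
    exact Finset.prod_eq_zero (Finset.mem_univ j) (if_neg hj)

lemma integral_herms_mul_herms (m n : Fin d → ℕ) :
    ∫ w, herms m w * herms n w ∂stdLaw d = if m = n then multiFact n else 0 := by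
  simp only [herms, ← Finset.prod_mul_distrib]
  rw [integral_stdLaw_prod fun j x => (herm (m j)).eval x * (herm (n j)).eval x]
  simp only [integral_herm_mul_herm]
  rw [prod_ite_eq_funext, multiFact]

/-- The three-term recurrence in one coordinate; it makes the span of the Hermite products stable
under multiplication by coordinates. When `m j = 0` the truncated index `m j - 1` is harmless, its
coefficient being zero. -/
lemma eval_mul_herms (m : Fin d → ℕ) (j : Fin d) (w : Fin d → ℝ) :
    w j * herms m w = herms (Function.update m j (m j + 1)) w +
      (m j : ℝ) * herms (Function.update m j (m j - 1)) w := by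
  have h (n : ℕ) : herms (Function.update m j n) w =
      (herm n).eval (w j) * ∏ k ∈ Finset.univ.erase j, (herm (m k)).eval (w k) := by
    rw [herms, ← Finset.mul_prod_erase _ _ (Finset.mem_univ j), Function.update_self]
    congr 1
    refine Finset.prod_congr rfl fun k hk => ?_
    rw [Function.update_of_ne (Finset.ne_of_mem_erase hk)]
  have h0 : herms m w = herms (Function.update m j (m j)) w := by rw [Function.update_eq_self]
  rw [h0, h, h, h]
  rcases hm : m j with _ | n
  · simp [herm_zero, herm_one]
  · have := congrArg (Polynomial.eval (w j)) (X_mul_herm_succ n)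
    simp only [Polynomial.eval_mul, Polynomial.eval_X, Polynomial.eval_add,
      Polynomial.eval_C] at this
    rw [← mul_assoc, this, Nat.add_sub_cancel]
    push_cast
    ring

end HermiteProducts

/-! ### Integrability of polynomials in the coordinates of a pair. -/

section Coordinates

variable {d : ℕ}

lemma HasExpMoments.hasAllMoments {E : Type*} [NormedAddCommGroup E] [NormedSpace ℝ E]
    [MeasurableSpace E] [BorelSpace E] {μ : Measure E} (h : HasExpMoments μ)
    (L : StrongDual ℝ E) : HasAllMoments μ L := by
  intro p hp
  lift p to NNReal using hp
  refine memLp_of_mem_interior_integrableExpSet ?_ p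
  have : integrableExpSet L μ = Set.univ := by
    refine Set.eq_univ_of_forall fun t => ?_
    refine (h (t • L)).mono' (by fun_prop) (ae_of_all _ fun z => ?_)
    simp only [Real.norm_eq_abs, Real.abs_exp, smul_apply, smul_eq_mul]
    exact Real.exp_le_exp.2 (le_abs_self _)
  rw [this, interior_univ]
  trivial

/-- All coordinates of the pair have moments of all orders. -/
def PairMoments (μ : Measure ((Fin d → ℝ) × (Fin d → ℝ))) : Prop :=
  ∀ i, HasAllMoments μ (fun z => z.1 i) ∧ HasAllMoments μ (fun z => z.2 i)

lemma HasExpMoments.pairMoments {μ : Measure ((Fin d → ℝ) × (Fin d → ℝ))} (h : HasExpMoments μ) :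
    PairMoments μ := fun i =>
  ⟨h.hasAllMoments ((ContinuousLinearMap.proj i).comp (.fst ℝ _ _)),
    h.hasAllMoments ((ContinuousLinearMap.proj i).comp (.snd ℝ _ _))⟩

variable {μ : Measure ((Fin d → ℝ) × (Fin d → ℝ))} [IsFiniteMeasure μ]

lemma PairMoments.eval (h : PairMoments μ) (q : MvPolynomial (Fin d ⊕ Fin d) ℝ) :
    HasAllMoments μ fun z => MvPolynomial.eval (Sum.elim z.1 z.2) q := by
  have hf : ∀ i : Fin d ⊕ Fin d,
      HasAllMoments μ fun z => (Sum.elim z.1 z.2 : Fin d ⊕ Fin d → ℝ) i := by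
    rintro (i | i)
    exacts [(h i).1, (h i).2]
  exact HasAllMoments.mvPolynomial hf q

lemma PairMoments.herms_fst (h : PairMoments μ) (T : (Fin d → ℝ) →L[ℝ] (Fin d → ℝ))
    (n : Fin d → ℕ) : HasAllMoments μ fun z => herms n (T z.1) := by
  refine HasAllMoments.prod _ fun j => HasAllMoments.polynomial ?_ _
  have e (z : (Fin d → ℝ) × (Fin d → ℝ)) := dual_pi_apply ((ContinuousLinearMap.proj j).comp T) z.1
  simp only [ContinuousLinearMap.comp_apply, ContinuousLinearMap.proj_apply] at e
  simp only [e]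
  exact HasAllMoments.sum _ fun i => (HasAllMoments.const _).mul (h i).1

lemma PairMoments.herms_snd (h : PairMoments μ) (T : (Fin d → ℝ) →L[ℝ] (Fin d → ℝ))
    (n : Fin d → ℕ) : HasAllMoments μ fun z => herms n (T z.2) := by
  refine HasAllMoments.prod _ fun j => HasAllMoments.polynomial ?_ _
  have e (z : (Fin d → ℝ) × (Fin d → ℝ)) := dual_pi_apply ((ContinuousLinearMap.proj j).comp T) z.2
  simp only [ContinuousLinearMap.comp_apply, ContinuousLinearMap.proj_apply] at e
  simp only [e]
  exact HasAllMoments.sum _ fun i => (HasAllMoments.const _).mul (h i).2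

end Coordinates

/-! ### Mehler's formula for mixed Hermite moments. -/

section MehlerMoments

variable {d : ℕ}

/-- Given the first vector `x`, averaging over the independent noise multiplies the `n`-th Hermite
product at `x` by `∏ ξ_j ^ n_j` (`integral_herm_add` in each coordinate); orthogonality finishes. -/
lemma integral_herms_mehlerLaw {ξ : Fin d → ℝ} (hξ : ∀ j, ξ j ∈ Set.Icc (-1 : ℝ) 1)
    (m n : Fin d → ℕ) :
    ∫ z, herms m z.1 * herms n z.2 ∂mehlerLaw ξ =
      if m = n then (∏ j, ξ j ^ n j) * multiFact n else 0 := by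
  have hint : Integrable (fun z => herms m z.1 * herms n z.2) (mehlerLaw ξ) := by
    have h := (IsGaussian.hasExpMoments (mehlerLaw ξ)).pairMoments
    exact ((h.herms_fst (.id ℝ _) m).mul (h.herms_snd (.id ℝ _) n)).integrable
  have hm : AEMeasurable (mehlerMap ξ) ((stdLaw d).prod (stdLaw d)) := by fun_prop
  have hint' : Integrable (fun z => herms m (mehlerMap ξ z).1 * herms n (mehlerMap ξ z).2)
      ((stdLaw d).prod (stdLaw d)) := hint.comp_aemeasurable (f := mehlerMap ξ) hm
  rw [mehlerLaw, integral_map hm hint.1]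
  rw [integral_prod _ hint']
  simp only [mehlerMap_fst]
  have hs (j : Fin d) : ξ j ^ 2 + √(1 - ξ j ^ 2) ^ 2 = 1 := by
    rw [Real.sq_sqrt]
    · ring
    · have := hξ j
      nlinarith [this.1, this.2]
  have inner (x : Fin d → ℝ) : ∫ y, herms m x * herms n (mehlerMap ξ (x, y)).2 ∂stdLaw d =
      (∏ j, ξ j ^ n j) * (herms m x * herms n x) := by
    rw [integral_const_mul]
    have : ∫ y, herms n (mehlerMap ξ (x, y)).2 ∂stdLaw d = (∏ j, ξ j ^ n j) * herms n x := by
      simp only [herms, mehlerMap_snd]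
      rw [integral_stdLaw_prod fun j y =>
        (herm (n j)).eval (ξ j * x j + √(1 - ξ j ^ 2) * y), ← Finset.prod_mul_distrib]
      exact Finset.prod_congr rfl fun j _ => integral_herm_add (hs j) _ _
    rw [this]; ring
  simp only [inner, integral_const_mul, integral_herms_mul_herms]
  split_ifs <;> simp

end MehlerMoments

/-! ### Hermite products in the original coordinates. -/

section Psi

variable {d : ℕ} (τ : Fin d → ℝ) (u : Fin d → Fin d → ℝ) (a : Fin d → ℝ)

/-- The normalization of `multiHermite` in which its squared norm is `multiFact n`. -/
noncomputable def psi (n : Fin d → ℕ) (x : Fin d → ℝ) : ℝ := herms n (whiten τ u a x)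

lemma psi_zero (x : Fin d → ℝ) : psi τ u a 0 x = 1 := herms_zero _

@[fun_prop]
lemma continuous_psi (n : Fin d → ℕ) : Continuous (psi τ u a n) := by
  unfold psi; fun_prop

/-- The normalizing constant of `multiHermite`. -/
noncomputable def scaleProd (n : Fin d → ℕ) : ℝ := ∏ j, scale τ a j ^ n j

lemma multiHermite_eq (n : Fin d → ℕ) (x : Fin d → ℝ) :
    multiHermite τ u a n x = scaleProd τ a n * psi τ u a n x := by
  simp only [multiHermite, scaleProd, psi, herms, ← Finset.prod_mul_distrib, hermiteCheb,
    whiten_apply, aeval_hermite, scale]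

variable {τ u a} [NeZero d]

lemma scaleProd_pos (hτ : ∀ i, 0 < τ i) (hu : IsOrthogonalBasis (prob τ) u a) (n : Fin d → ℕ) :
    0 < scaleProd τ a n :=
  Finset.prod_pos fun j _ => pow_pos (scale_pos hτ hu j) _

lemma hInv_eq (hτ : ∀ i, 0 < τ i) (hu : IsOrthogonalBasis (prob τ) u a) (n : Fin d → ℕ) :
    hInv τ a n = (multiFact n * scaleProd τ a n ^ 2)⁻¹ := by
  rw [hInv, multiFact, scaleProd, ← Finset.prod_pow, ← Finset.prod_mul_distrib]
  congr 1
  refine Finset.prod_congr rfl fun j _ => ?_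
  rw [← scale_sq hτ hu, ← pow_mul, ← pow_mul, mul_comm 2]

lemma term_eq (hτ : ∀ i, 0 < τ i) (hu : IsOrthogonalBasis (prob τ) u a) (ρ : (Fin d → ℕ) → ℝ)
    (n : Fin d → ℕ) (z : (Fin d → ℝ) × (Fin d → ℝ)) :
    term τ u a ρ n z = ρ n / multiFact n * (psi τ u a n z.1 * psi τ u a n z.2) := by
  rw [term, multiHermite_eq, multiHermite_eq, hInv_eq hτ hu]
  have := (scaleProd_pos hτ hu n).ne'
  have := (multiFact_pos n).ne'
  field_simp

lemma map_whiten (hτ : ∀ i, 0 < τ i) (hu : IsOrthogonalBasis (prob τ) u a) :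
    (normalLaw τ).map (whiten τ u a) = stdLaw d := by
  -- Only the first marginal of the pair is used, so any `ξ` in the cube would serve.
  have h := (isNormalPair_pairLaw hτ hu (ξ := 0) (by simp)).fst_eq fun i => (hτ i).le
  rw [← h, pairLaw, mehlerLaw, Measure.fst, Measure.map_map (by fun_prop) (by fun_prop),
    Measure.map_map (by fun_prop) (by fun_prop), Measure.map_map (by fun_prop) (by fun_prop)]
  have e : ((whiten τ u a ∘ Prod.fst) ∘ ((unwhiten τ u a).prodMap (unwhiten τ u a))) ∘
      mehlerMap (0 : Fin d → ℝ) = Prod.fst := by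
    ext1 z
    exact whiten_unwhiten hτ hu z.1
  rw [e, Measure.map_fst_prod]
  simp

lemma integral_comp_whiten (hτ : ∀ i, 0 < τ i) (hu : IsOrthogonalBasis (prob τ) u a)
    {f : (Fin d → ℝ) → ℝ} (hf : Continuous f) :
    ∫ x, f (whiten τ u a x) ∂normalLaw τ = ∫ w, f w ∂stdLaw d := by
  rw [← map_whiten hτ hu, integral_map (by fun_prop) (by fun_prop)]

lemma integral_psi_mul_psi (hτ : ∀ i, 0 < τ i) (hu : IsOrthogonalBasis (prob τ) u a)
    (m n : Fin d → ℕ) :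
    ∫ x, psi τ u a m x * psi τ u a n x ∂normalLaw τ = if m = n then multiFact n else 0 := by
  rw [← integral_herms_mul_herms, ← integral_comp_whiten hτ hu (by fun_prop)]
  rfl

lemma integral_psi_pairLaw (hτ : ∀ i, 0 < τ i) (hu : IsOrthogonalBasis (prob τ) u a)
    {ξ : Fin d → ℝ} (hξ : ∀ j, ξ j ∈ Set.Icc (-1 : ℝ) 1) (m n : Fin d → ℕ) :
    ∫ z, psi τ u a m z.1 * psi τ u a n z.2 ∂pairLaw τ u a ξ =
      if m = n then (∏ j, ξ j ^ n j) * multiFact n else 0 := by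
  rw [← integral_herms_mehlerLaw hξ, pairLaw, integral_map (by fun_prop) (by fun_prop)]
  congr 1
  ext1 z
  change herms m (whiten τ u a (unwhiten τ u a z.1)) *
    herms n (whiten τ u a (unwhiten τ u a z.2)) = _
  rw [whiten_unwhiten hτ hu, whiten_unwhiten hτ hu]

/-- The polynomial functions of `(x, y)` are spanned by the products `ψ_m(x) ψ_n(y)`. -/
lemma eval_mem_span_psi (hτ : ∀ i, 0 < τ i) (hu : IsOrthogonalBasis (prob τ) u a)
    (q : MvPolynomial (Fin d ⊕ Fin d) ℝ) :
    (fun z : (Fin d → ℝ) × (Fin d → ℝ) => MvPolynomial.eval (Sum.elim z.1 z.2) q) ∈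
      Submodule.span ℝ (Set.range fun (p : (Fin d → ℕ) × (Fin d → ℕ))
        (z : (Fin d → ℝ) × (Fin d → ℝ)) => psi τ u a p.1 z.1 * psi τ u a p.2 z.2) := by
  set W := Submodule.span ℝ (Set.range fun (p : (Fin d → ℕ) × (Fin d → ℕ))
        (z : (Fin d → ℝ) × (Fin d → ℝ)) => psi τ u a p.1 z.1 * psi τ u a p.2 z.2) with hW
  have hb (m n : Fin d → ℕ) : (fun z : (Fin d → ℝ) × (Fin d → ℝ) =>
      psi τ u a m z.1 * psi τ u a n z.2) ∈ W := Submodule.subset_span ⟨(m, n), rfl⟩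
  -- The span is stable under multiplication by whitened coordinates, and original coordinates are
  -- linear combinations of these (`hS`), so induction on the polynomial applies.
  have h1 (j : Fin d) (f : (Fin d → ℝ) × (Fin d → ℝ) → ℝ) (hf : f ∈ W) :
      (fun z => whiten τ u a z.1 j * f z) ∈ W := by
    induction hf using Submodule.span_induction with
    | mem f hf =>
      obtain ⟨⟨m, n⟩, rfl⟩ := hf
      have := W.add_mem (hb (Function.update m j (m j + 1)) n)
        (W.smul_mem (m j : ℝ) (hb (Function.update m j (m j - 1)) n))
      convert this using 1
      ext1 z
      simp only [psi, Pi.add_apply, Pi.smul_apply, smul_eq_mul]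
      rw [← mul_assoc, eval_mul_herms]; ring
    | zero =>
      convert W.zero_mem using 1
      ext1 z; simp
    | add f g _ _ hf hg =>
      convert W.add_mem hf hg using 1
      ext1 z; simp [mul_add]
    | smul c f _ hf =>
      convert W.smul_mem c hf using 1
      ext1 z; simp [mul_left_comm]
  have h2 (j : Fin d) (f : (Fin d → ℝ) × (Fin d → ℝ) → ℝ) (hf : f ∈ W) :
      (fun z => whiten τ u a z.2 j * f z) ∈ W := by
    induction hf using Submodule.span_induction with
    | mem f hf =>
      obtain ⟨⟨m, n⟩, rfl⟩ := hf
      have := W.add_mem (hb m (Function.update n j (n j + 1)))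
        (W.smul_mem (n j : ℝ) (hb m (Function.update n j (n j - 1))))
      convert this using 1
      ext1 z
      simp only [psi, Pi.add_apply, Pi.smul_apply, smul_eq_mul]
      rw [mul_left_comm, eval_mul_herms]; ring
    | zero =>
      convert W.zero_mem using 1
      ext1 z; simp
    | add f g _ _ hf hg =>
      convert W.add_mem hf hg using 1
      ext1 z; simp [mul_add]
    | smul c f _ hf =>
      convert W.smul_mem c hf using 1
      ext1 z; simp [mul_left_comm]
  have hS (x : Fin d → ℝ) (i : Fin d) : x i =
      ∑ j, prob τ i * (u j i * (scale τ a j / a j)) * whiten τ u a x j := by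
    conv_lhs => rw [← unwhiten_whiten hτ hu x, unwhiten, linComb_apply]
  induction q using MvPolynomial.induction_on with
  | C c =>
    convert W.smul_mem c (hb 0 0) using 1
    ext1 z; simp [psi_zero]
  | add p q hp hq =>
    convert W.add_mem hp hq using 1
    ext1 z; simp
  | mul_X p i hp =>
    rcases i with i | i
    · convert W.sum_mem fun j (_ : j ∈ Finset.univ) =>
        W.smul_mem (prob τ i * (u j i * (scale τ a j / a j))) (h1 j _ hp) using 1
      ext1 z
      simp only [map_mul, MvPolynomial.eval_X, Sum.elim_inl, Finset.sum_apply, Pi.smul_apply,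
        smul_eq_mul]
      rw [mul_comm]
      nth_rewrite 1 [hS z.1 i]
      rw [Finset.sum_mul]
      exact Finset.sum_congr rfl fun j _ => by ring
    · convert W.sum_mem fun j (_ : j ∈ Finset.univ) =>
        W.smul_mem (prob τ i * (u j i * (scale τ a j / a j))) (h2 j _ hp) using 1
      ext1 z
      simp only [map_mul, MvPolynomial.eval_X, Sum.elim_inr, Finset.sum_apply, Pi.smul_apply,
        smul_eq_mul]
      rw [mul_comm]
      nth_rewrite 1 [hS z.2 i]
      rw [Finset.sum_mul]
      exact Finset.sum_congr rfl fun j _ => by ring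

/-- Determinacy in terms of the Hermite polynomials. -/
lemma ext_of_psi (hτ : ∀ i, 0 < τ i) (hu : IsOrthogonalBasis (prob τ) u a)
    {μ ν : Measure ((Fin d → ℝ) × (Fin d → ℝ))} [IsFiniteMeasure μ] [IsFiniteMeasure ν]
    (hμ : HasExpMoments μ) (hν : HasExpMoments ν)
    (h : ∀ m n, ∫ z, psi τ u a m z.1 * psi τ u a n z.2 ∂μ =
      ∫ z, psi τ u a m z.1 * psi τ u a n z.2 ∂ν) : μ = ν := by
  have key (f : (Fin d → ℝ) × (Fin d → ℝ) → ℝ) (hf : f ∈ Submodule.span ℝ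
      (Set.range fun (p : (Fin d → ℕ) × (Fin d → ℕ)) (z : (Fin d → ℝ) × (Fin d → ℝ)) =>
        psi τ u a p.1 z.1 * psi τ u a p.2 z.2)) :
      Integrable f μ ∧ Integrable f ν ∧ ∫ z, f z ∂μ = ∫ z, f z ∂ν := by
    induction hf using Submodule.span_induction with
    | mem f hf =>
      obtain ⟨⟨m, n⟩, rfl⟩ := hf
      exact ⟨((hμ.pairMoments.herms_fst _ m).mul (hμ.pairMoments.herms_snd _ n)).integrable,
        ((hν.pairMoments.herms_fst _ m).mul (hν.pairMoments.herms_snd _ n)).integrable, h m n⟩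
    | zero => simp
    | add f g _ _ hf hg =>
      refine ⟨hf.1.add hg.1, hf.2.1.add hg.2.1, ?_⟩
      simp only [Pi.add_apply]
      rw [integral_add hf.1 hg.1, integral_add hf.2.1 hg.2.1, hf.2.2, hg.2.2]
    | smul c f _ hf =>
      refine ⟨hf.1.smul c, hf.2.1.smul c, ?_⟩
      simp only [Pi.smul_apply, smul_eq_mul, integral_const_mul, hf.2.2]
  -- A power of a linear functional is a polynomial in the coordinates, hence lies in the span
  -- covered by `key`.
  refine ext_of_moments hμ hν fun L k => ?_
  have e (z : (Fin d → ℝ) × (Fin d → ℝ)) : L z ^ k = MvPolynomial.eval (Sum.elim z.1 z.2)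
      ((∑ i, MvPolynomial.C (L (Pi.single i 1, 0)) * MvPolynomial.X (Sum.inl i) +
        ∑ i, MvPolynomial.C (L (0, Pi.single i 1)) * MvPolynomial.X (Sum.inr i)) ^ k) := by
    rw [dual_prod_apply]; simp
  simp only [e]
  exact (key _ (eval_mem_span_psi hτ hu _)).2.2

end Psi

/-! ### The moment problem on the cube. -/

section MomentProblem

open MvPolynomial

variable {d : ℕ}

/-- The linear functional on polynomials with moments `ρ`. -/
noncomputable def momentFunctional (ρ : (Fin d → ℕ) → ℝ) : MvPolynomial (Fin d) ℝ →ₗ[ℝ] ℝ :=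
  (basisMonomials (Fin d) ℝ).constr ℝ fun n => ρ n

lemma momentFunctional_monomial (ρ : (Fin d → ℕ) → ℝ) (n : Fin d →₀ ℕ) (c : ℝ) :
    momentFunctional ρ (monomial n c) = c * ρ n := by
  have h : monomial n c = c • basisMonomials (Fin d) ℝ n := by
    simp [coe_basisMonomials, smul_monomial]
  rw [h, map_smul, momentFunctional, Module.Basis.constr_basis, smul_eq_mul]

lemma momentFunctional_apply (ρ : (Fin d → ℕ) → ℝ) (r : MvPolynomial (Fin d) ℝ) :
    momentFunctional ρ r = ∑ n ∈ r.support, coeff n r * ρ n := by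
  conv_lhs => rw [as_sum r, map_sum]
  simp only [momentFunctional_monomial]

lemma momentFunctional_C (ρ : (Fin d → ℕ) → ℝ) (c : ℝ) :
    momentFunctional ρ (C c) = c * ρ 0 := by
  rw [← monomial_zero', momentFunctional_monomial]; rfl

lemma momentFunctional_X_pow (ρ : (Fin d → ℕ) → ℝ) (j : Fin d) (k : ℕ) :
    momentFunctional ρ (X j ^ k) = ρ (Pi.single j k) := by
  rw [X_pow_eq_monomial, momentFunctional_monomial, one_mul, Finsupp.single_eq_pi_single]

lemma exists_growth_bound (r : MvPolynomial (Fin d) ℝ) :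
    ∃ (C : ℝ) (D : ℕ), 0 ≤ C ∧ ∀ t : Fin d → ℝ, 1 ≤ ‖t‖ → |eval t r| ≤ C * ‖t‖ ^ D := by
  induction r using MvPolynomial.induction_on with
  | C c => exact ⟨|c|, 0, abs_nonneg _, fun t _ => by simp⟩
  | add p q hp hq =>
    obtain ⟨C₁, D₁, h₁, hp⟩ := hp
    obtain ⟨C₂, D₂, h₂, hq⟩ := hq
    refine ⟨C₁ + C₂, max D₁ D₂, add_nonneg h₁ h₂, fun t ht => ?_⟩
    have e1 : ‖t‖ ^ D₁ ≤ ‖t‖ ^ max D₁ D₂ := pow_le_pow_right₀ ht (le_max_left _ _)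
    have e2 : ‖t‖ ^ D₂ ≤ ‖t‖ ^ max D₁ D₂ := pow_le_pow_right₀ ht (le_max_right _ _)
    calc |eval t (p + q)| ≤ |eval t p| + |eval t q| := by rw [map_add]; exact abs_add_le _ _
      _ ≤ C₁ * ‖t‖ ^ D₁ + C₂ * ‖t‖ ^ D₂ := add_le_add (hp t ht) (hq t ht)
      _ ≤ C₁ * ‖t‖ ^ max D₁ D₂ + C₂ * ‖t‖ ^ max D₁ D₂ := by gcongr
      _ = _ := by ring
  | mul_X p i hp =>
    obtain ⟨C, D, h, hp⟩ := hp
    refine ⟨C, D + 1, h, fun t ht => ?_⟩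
    rw [map_mul, eval_X, abs_mul, pow_succ, ← mul_assoc]
    have : |t i| ≤ ‖t‖ := norm_le_pi_norm t i
    gcongr
    exact hp t ht

/-- For large `K` the perturbation `r + ε + ε ∑ t_j ^ (2K)` is non-negative on all of `ℝᵈ`. The
functional sends the perturbing terms to at most `ε (1 + d)`, whatever `K` is, so `ε` can tend to
`0`. -/
lemma momentFunctional_nonneg_of_cube {ρ : (Fin d → ℕ) → ℝ} (h0 : ρ 0 = 1)
    (hpos : ∀ r : MvPolynomial (Fin d) ℝ, (∀ t, 0 ≤ eval t r) → 0 ≤ momentFunctional ρ r)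
    (hb : ∀ j k, ρ (Pi.single j (2 * k)) ≤ 1) (r : MvPolynomial (Fin d) ℝ)
    (hr : ∀ t : Fin d → ℝ, ‖t‖ ≤ 1 → 0 ≤ eval t r) : 0 ≤ momentFunctional ρ r := by
  have main (ε : ℝ) (hε : 0 < ε) : 0 ≤ momentFunctional ρ r + ε * (1 + d) := by
    obtain ⟨C₀, D, hC, hgrow⟩ := exists_growth_bound r
    have huc : UniformContinuousOn (fun t : Fin d → ℝ => eval t r) (Metric.closedBall 0 2) :=
      (isCompact_closedBall 0 2).uniformContinuousOn_of_continuous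
        (MvPolynomial.continuous_eval r).continuousOn
    obtain ⟨δ', hδ', hcont⟩ := Metric.uniformContinuousOn_iff.1 huc ε hε
    -- Halving gives `δ < δ'`; the cap `1` keeps the enlarged cube inside the ball of radius `2`.
    set δ := min (δ' / 2) 1 with hδ
    have hδ0 : 0 < δ := lt_min (by positivity) one_pos
    have hδ1 : δ ≤ 1 := min_le_right _ _
    have hδ2 : δ < δ' := (min_le_left _ _).trans_lt (by linarith)
    -- Scaling by `(1 + δ)⁻¹` brings `t` back into the cube while moving it by at most `δ`.
    have near (t : Fin d → ℝ) (ht : ‖t‖ ≤ 1 + δ) : -ε ≤ eval t r := by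
      have hn : ‖(1 + δ)⁻¹ • t‖ ≤ 1 := by
        rw [norm_smul, Real.norm_of_nonneg (by positivity), inv_mul_le_iff₀ (by positivity)]
        linarith
      have hd : dist t ((1 + δ)⁻¹ • t) < δ' := by
        have : t - (1 + δ)⁻¹ • t = (δ * (1 + δ)⁻¹) • t := by
          rw [← one_smul ℝ t, smul_smul, ← sub_smul, smul_smul]
          congr 1; field_simp; ring
        rw [dist_eq_norm, this, norm_smul, Real.norm_of_nonneg (by positivity)]
        refine lt_of_le_of_lt ?_ hδ2
        calc δ * (1 + δ)⁻¹ * ‖t‖ ≤ δ * (1 + δ)⁻¹ * (1 + δ) := by gcongr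
          _ = δ := by field_simp
      have := hcont t (by simpa using by linarith) ((1 + δ)⁻¹ • t) (by simpa using by linarith) hd
      rw [Real.dist_eq] at this
      have h1 := hr _ hn
      have h2 := (abs_lt.1 this).1
      linarith
    -- Outside the enlarged cube, one factor `‖t‖ ^ K` absorbs the constant `C₀ / ε` (as `K ≥ N`)
    -- and the other absorbs the growth `‖t‖ ^ D` (as `K ≥ D`).
    obtain ⟨N, hN⟩ := pow_unbounded_of_one_lt (C₀ / ε) (show 1 < 1 + δ by linarith)
    set K := max N D with hK
    have far (t : Fin d → ℝ) (ht : 1 + δ ≤ ‖t‖) : |eval t r| ≤ ε * ∑ j, t j ^ (2 * K) := by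
      have h1 : 1 ≤ ‖t‖ := by linarith
      obtain ⟨j, hj⟩ : ∃ j, ‖t‖ ≤ ‖t j‖ := by
        by_contra! hc
        exact lt_irrefl _ ((pi_norm_lt_iff (by linarith)).2 hc)
      have h2 : C₀ ≤ ε * ‖t‖ ^ K := by
        rw [div_lt_iff₀' hε] at hN
        have : (1 + δ) ^ N ≤ ‖t‖ ^ K :=
          (pow_le_pow_left₀ (by positivity) ht N).trans (pow_le_pow_right₀ h1 (le_max_left _ _))
        nlinarith
      calc |eval t r| ≤ C₀ * ‖t‖ ^ D := hgrow t h1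
        _ ≤ ε * ‖t‖ ^ K * ‖t‖ ^ K := by
          have : ‖t‖ ^ D ≤ ‖t‖ ^ K := pow_le_pow_right₀ h1 (le_max_right _ _)
          gcongr
        _ = ε * ‖t‖ ^ (2 * K) := by ring
        _ ≤ ε * ‖t j‖ ^ (2 * K) := by gcongr
        _ = ε * t j ^ (2 * K) := by rw [Real.norm_eq_abs, pow_mul, sq_abs, ← pow_mul]
        _ ≤ _ := by
          gcongr
          exact Finset.single_le_sum (f := fun j => t j ^ (2 * K))
            (fun i _ => by rw [pow_mul]; positivity) (Finset.mem_univ j)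
    have hall : 0 ≤ momentFunctional ρ (r + C ε + C ε * ∑ j, X j ^ (2 * K)) := by
      refine hpos _ fun t => ?_
      simp only [map_add, map_mul, eval_C, map_sum, map_pow, eval_X]
      have hs : 0 ≤ ∑ j, t j ^ (2 * K) :=
        Finset.sum_nonneg fun i _ => by rw [pow_mul]; positivity
      rcases le_total ‖t‖ (1 + δ) with h | h
      · have := near t h
        have := mul_nonneg hε.le hs
        linarith
      · have := neg_le_of_abs_le (far t h)
        linarith
    rw [map_add, map_add, momentFunctional_C, h0, ← smul_eq_C_mul, map_smul, map_sum] at hall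
    simp only [momentFunctional_X_pow, smul_eq_mul] at hall
    have hsum : ∑ j : Fin d, ρ (Pi.single j (2 * K)) ≤ d := by
      calc _ ≤ ∑ j : Fin d, (1 : ℝ) := Finset.sum_le_sum fun j _ => hb j K
        _ = d := by simp
    nlinarith
  refine le_of_forall_pos_le_add fun η hη => ?_
  have := main (η / (1 + d)) (by positivity)
  rwa [div_mul_cancel₀ _ (by positivity)] at this

lemma exists_measure_of_nonneg {X : Type*} [TopologicalSpace X] [CompactSpace X] [T2Space X]
    [MeasurableSpace X] [BorelSpace X] (Λ : C(X, ℝ) →ₗ[ℝ] ℝ)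
    (hΛ : ∀ f, (∀ x, 0 ≤ f x) → 0 ≤ Λ f) :
    ∃ μ : Measure X, IsFiniteMeasure μ ∧ ∀ f : C(X, ℝ), ∫ x, f x ∂μ = Λ f := by
  let L : CompactlySupportedContinuousMap X ℝ →ₗ[ℝ] ℝ :=
    { toFun := fun f => Λ f.toContinuousMap
      map_add' := fun f g => by rw [← map_add]; rfl
      map_smul' := fun c f => by rw [RingHom.id_apply, ← map_smul]; rfl }
  let P : CompactlySupportedContinuousMap X ℝ →ₚ[ℝ] ℝ :=
    PositiveLinearMap.mk₀ L fun f hf => hΛ _ fun x => hf x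
  refine ⟨RealRMK.rieszMeasure P, ?_, fun f => ?_⟩
  · infer_instance
  · exact RealRMK.integral_rieszMeasure P (CompactlySupportedContinuousMap.continuousMapEquiv f)

/-- The Riesz extension theorem is applied on pairs `(r, f)` of a polynomial and a continuous
function, with the cone `r + f ≥ 0` on `K`. Distinct polynomials may agree on `K`, so the
polynomials are not treated as a subspace of `C(K, ℝ)`. -/
lemma exists_extension_of_nonneg {K : Set (Fin d → ℝ)} (hK : IsCompact K)
    (M : MvPolynomial (Fin d) ℝ →ₗ[ℝ] ℝ)
    (hM : ∀ r, (∀ t ∈ K, 0 ≤ eval t r) → 0 ≤ M r) :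
    ∃ Λ : C(K, ℝ) →ₗ[ℝ] ℝ, (∀ f, (∀ x, 0 ≤ f x) → 0 ≤ Λ f) ∧
      ∀ r (f : C(K, ℝ)), (∀ x : K, f x = eval x r) → Λ f = M r := by
  have := isCompact_iff_compactSpace.1 hK
  let s : PointedCone ℝ (MvPolynomial (Fin d) ℝ × C(K, ℝ)) :=
    { carrier := {p | ∀ x : K, 0 ≤ eval (x : Fin d → ℝ) p.1 + p.2 x}
      add_mem' := fun {p q} hp hq x => by
        have h1 := hp x
        have h2 := hq x
        simp only [Prod.fst_add, Prod.snd_add, map_add, ContinuousMap.add_apply]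
        linarith
      zero_mem' := fun x => by simp
      smul_mem' := fun c p hp x => by
        have h1 := mul_nonneg c.2 (hp x)
        have e : eval (x : Fin d → ℝ) (c • p).1 + (c • p).2 x =
            (c : ℝ) * (eval (x : Fin d → ℝ) p.1 + p.2 x) := by
          change eval (x : Fin d → ℝ) ((c : ℝ) • p.1) + (c : ℝ) * p.2 x = _
          rw [smul_eval]; ring
        rw [e]; exact h1 }
  let f : (MvPolynomial (Fin d) ℝ × C(K, ℝ)) →ₗ.[ℝ] ℝ :=
    { domain := Submodule.prod ⊤ ⊥
      toFun := M ∘ₗ LinearMap.fst ℝ _ _ ∘ₗ Submodule.subtype _ }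
  obtain ⟨g, hg1, hg2⟩ := riesz_extension s f
    (fun x hx => by
      refine hM _ fun t ht => ?_
      have h1 := hx ⟨t, ht⟩
      have h2 : x.1.2 = 0 := x.2.2
      rw [h2] at h1
      simpa using h1)
    (fun y => by
      -- Adding this pair to `y` leaves `‖f‖ + f ≥ 0` on `K`, where `f` is `y.2`.
      refine ⟨⟨(C ‖y.2‖ - y.1, 0), ⟨trivial, rfl⟩⟩, fun x => ?_⟩
      have := (abs_le.1 (y.2.norm_coe_le_norm x)).1
      simp only [Prod.fst_add, Prod.snd_add, map_add, map_sub, eval_C, ContinuousMap.add_apply,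
        ContinuousMap.zero_apply]
      linarith)
  refine ⟨g ∘ₗ LinearMap.inr ℝ _ _, fun f hf => hg2 _ fun x => ?_, fun r f hf => ?_⟩
  · simpa using hf x
  -- When `f = r` on `K`, both `(r, -f)` and its negative lie in the cone, which forces `g (0, f) =
  -- g (r, 0)`.
  · have h1 : 0 ≤ g (r, -f) := hg2 _ fun x => by simp [hf x]
    have h2 : 0 ≤ g (-r, f) := hg2 _ fun x => by simp [hf x]
    have h3 : g (r, 0) = M r := hg1 ⟨(r, 0), ⟨trivial, rfl⟩⟩
    have e1 : ((r, -f) : MvPolynomial (Fin d) ℝ × C(K, ℝ)) = (r, 0) - (0, f) := by simp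
    have e2 : ((-r, f) : MvPolynomial (Fin d) ℝ × C(K, ℝ)) = (0, f) - (r, 0) := by simp
    rw [e1, map_sub, h3] at h1
    rw [e2, map_sub, h3] at h2
    change g (0, f) = M r
    linarith

/-- The moment problem on the cube, for functionals nonnegative on nonnegative polynomials. -/
theorem exists_cubeLaw {ρ : (Fin d → ℕ) → ℝ} (h0 : ρ 0 = 1)
    (hpos : ∀ r : MvPolynomial (Fin d) ℝ, (∀ t, 0 ≤ eval t r) → 0 ≤ momentFunctional ρ r)
    (hb : ∀ j k, ρ (Pi.single j (2 * k)) ≤ 1) : ∃ φ, IsCubeLaw φ ∧ HasMoments φ ρ := by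
  -- The norm is the supremum norm, so this ball is the cube `[-1, 1]ᵈ`.
  have hKc : IsCompact (Metric.closedBall (0 : Fin d → ℝ) 1) := isCompact_closedBall 0 1
  have := isCompact_iff_compactSpace.1 hKc
  obtain ⟨Λ, hΛ, hΛM⟩ := exists_extension_of_nonneg hKc (momentFunctional ρ) fun r hr =>
    momentFunctional_nonneg_of_cube h0 hpos hb r fun t ht => hr t (by simpa using ht)
  obtain ⟨μ, hμ, hint⟩ := exists_measure_of_nonneg Λ hΛ
  have hpoly (r : MvPolynomial (Fin d) ℝ) :
      ∫ t, eval t r ∂(μ.map Subtype.val) = momentFunctional ρ r := by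
    rw [integral_map (by fun_prop) (MvPolynomial.continuous_eval r).aestronglyMeasurable]
    have := hint ⟨fun x => eval (x : Fin d → ℝ) r,
      (MvPolynomial.continuous_eval r).comp continuous_subtype_val⟩
    rw [hΛM r _ fun x => rfl] at this
    exact this
  refine ⟨μ.map Subtype.val, ⟨?_, ?_⟩, fun n => ?_⟩
  · have h1 := hpoly (C 1)
    rw [momentFunctional_C, h0] at h1
    simp only [eval_C, integral_const, smul_eq_mul, mul_one] at h1
    exact ⟨by rwa [Measure.real, ENNReal.toReal_eq_one_iff] at h1⟩
  · rw [ae_map_iff (by fun_prop)]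
    · refine ae_of_all _ fun x j => ?_
      have hx : ‖(x : Fin d → ℝ)‖ ≤ 1 := mem_closedBall_zero_iff.1 x.2
      exact abs_le.1 ((norm_le_pi_norm (x : Fin d → ℝ) j).trans hx)
    · simp only [Set.ofPred_forall]
      exact MeasurableSet.iInter fun j => measurable_pi_apply j measurableSet_Icc
  · have h1 := hpoly (monomial (Finsupp.equivFunOnFinite.symm n) 1)
    rw [momentFunctional_monomial, one_mul] at h1
    simp only [eval_monomial, one_mul, Finsupp.prod_fintype _ _ (fun _ => pow_zero _)] at h1
    simpa using h1.symm

end MomentProblem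

/-! ### Laws with the expansion and conditionally normal laws. -/

section Expansion

variable {d : ℕ} {τ : Fin d → ℝ} {u : Fin d → Fin d → ℝ} {a : Fin d → ℝ}

/-- The moment relations `E[ψ_m(X) ψ_n(Y)] = δ_{mn} ρ_n n!`. -/
def HasPsiMoments (τ : Fin d → ℝ) (u : Fin d → Fin d → ℝ) (a : Fin d → ℝ)
    (ρ : (Fin d → ℕ) → ℝ) (μ : Measure ((Fin d → ℝ) × (Fin d → ℝ))) : Prop :=
  ∀ m n, ∫ z, psi τ u a m z.1 * psi τ u a n z.2 ∂μ = if m = n then ρ n * multiFact n else 0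

lemma hasExpMoments_of_marginals {μ : Measure ((Fin d → ℝ) × (Fin d → ℝ))}
    (h1 : μ.fst = normalLaw τ) (h2 : μ.snd = normalLaw τ) : HasExpMoments μ :=
  HasExpMoments.of_marginals (h1 ▸ IsGaussian.hasExpMoments _) (h2 ▸ IsGaussian.hasExpMoments _)

lemma PairMoments.psi_mul_psi {μ : Measure ((Fin d → ℝ) × (Fin d → ℝ))} [IsFiniteMeasure μ]
    (h : PairMoments μ) (m n : Fin d → ℕ) :
    HasAllMoments μ fun z => psi τ u a m z.1 * psi τ u a n z.2 :=
  (h.herms_fst _ m).mul (h.herms_snd _ n)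

variable [NeZero d]

lemma HasExpansion.hasPsiMoments (hτ : ∀ i, 0 < τ i) (hu : IsOrthogonalBasis (prob τ) u a)
    {ρ : (Fin d → ℕ) → ℝ} {μ : Measure ((Fin d → ℝ) × (Fin d → ℝ))}
    (h : HasExpansion τ u a ρ μ) : HasPsiMoments τ u a ρ μ := by
  intro m n
  have h1 := h.integral_eq m n
  have hm := (scaleProd_pos hτ hu m).ne'
  have hn := (scaleProd_pos hτ hu n).ne'
  have hf := (multiFact_pos n).ne'
  have e (z : (Fin d → ℝ) × (Fin d → ℝ)) : multiHermite τ u a m z.1 * multiHermite τ u a n z.2 =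
      (scaleProd τ a m * scaleProd τ a n) * (psi τ u a m z.1 * psi τ u a n z.2) := by
    rw [multiHermite_eq, multiHermite_eq]; ring
  simp only [e, integral_const_mul] at h1
  split_ifs with hmn
  · subst hmn
    rw [if_pos rfl, hInv_eq hτ hu] at h1
    field_simp at h1
    linarith
  · rw [if_neg hmn] at h1
    exact (mul_eq_zero.1 h1).resolve_left (mul_ne_zero hm hn)

lemma HasPsiMoments.hasExpansion (hτ : ∀ i, 0 < τ i) (hu : IsOrthogonalBasis (prob τ) u a)
    {ρ : (Fin d → ℕ) → ℝ} {μ : Measure ((Fin d → ℝ) × (Fin d → ℝ))} [IsFiniteMeasure μ]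
    (h : HasPsiMoments τ u a ρ μ) (h1 : μ.fst = normalLaw τ) (h2 : μ.snd = normalLaw τ) :
    HasExpansion τ u a ρ μ := by
  have e (m n : Fin d → ℕ) (z : (Fin d → ℝ) × (Fin d → ℝ)) :
      multiHermite τ u a m z.1 * multiHermite τ u a n z.2 =
      (scaleProd τ a m * scaleProd τ a n) * (psi τ u a m z.1 * psi τ u a n z.2) := by
    rw [multiHermite_eq, multiHermite_eq]; ring
  refine ⟨h1, h2, fun m n => ?_, fun m n => ?_⟩
  · simp only [e]
    exact ((hasExpMoments_of_marginals h1 h2).pairMoments.psi_mul_psi m n).integrable.const_mul _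
  · simp only [e, integral_const_mul, h m n]
    split_ifs with hmn
    · subst hmn
      rw [hInv_eq hτ hu]
      have hm := (scaleProd_pos hτ hu m).ne'
      have hf := (multiFact_pos m).ne'
      field_simp
    · rw [mul_zero]

lemma HasPsiMoments.unique (hτ : ∀ i, 0 < τ i) (hu : IsOrthogonalBasis (prob τ) u a)
    {ρ : (Fin d → ℕ) → ℝ} {μ ν : Measure ((Fin d → ℝ) × (Fin d → ℝ))} [IsFiniteMeasure μ]
    [IsFiniteMeasure ν] (hμ : HasExpMoments μ) (hν : HasExpMoments ν)
    (h1 : HasPsiMoments τ u a ρ μ) (h2 : HasPsiMoments τ u a ρ ν) : μ = ν :=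
  ext_of_psi hτ hu hμ hν fun m n => (h1 m n).trans (h2 m n).symm

lemma IsConditionallyNormal.properties (hτ : ∀ i, 0 < τ i)
    (hu : IsOrthogonalBasis (prob τ) u a) {φ : Measure (Fin d → ℝ)} (hφ : IsCubeLaw φ)
    {μ : Measure ((Fin d → ℝ) × (Fin d → ℝ))} (h : IsConditionallyNormal τ u a φ μ) :
    IsProbabilityMeasure μ ∧ μ.fst = normalLaw τ ∧ μ.snd = normalLaw τ ∧
      HasPsiMoments τ u a (fun n => ∫ ξ, ∏ j, ξ j ^ n j ∂φ) μ := by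
  obtain ⟨κ, hκ, hpair, rfl⟩ := h
  have := hφ.isProbabilityMeasure
  have hm : IsProbabilityMeasure (φ.bind κ) := by infer_instance
  have h1 : (φ.bind κ).fst = normalLaw τ := by
    ext s hs
    rw [Measure.fst_apply hs, Measure.bind_apply (measurable_fst hs) κ.measurable.aemeasurable]
    have : ∀ᵐ ξ ∂φ, κ ξ (Prod.fst ⁻¹' s) = normalLaw τ s := by
      filter_upwards [hpair] with ξ hξ
      rw [← Measure.fst_apply hs, hξ.fst_eq fun i => (hτ i).le]
    rw [lintegral_congr_ae this]; simp
  have h2 : (φ.bind κ).snd = normalLaw τ := by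
    ext s hs
    rw [Measure.snd_apply hs, Measure.bind_apply (measurable_snd hs) κ.measurable.aemeasurable]
    have : ∀ᵐ ξ ∂φ, κ ξ (Prod.snd ⁻¹' s) = normalLaw τ s := by
      filter_upwards [hpair] with ξ hξ
      rw [← Measure.snd_apply hs, hξ.snd_eq fun i => (hτ i).le]
    rw [lintegral_congr_ae this]; simp
  refine ⟨hm, h1, h2, fun m n => ?_⟩
  have hint := ((hasExpMoments_of_marginals h1 h2).pairMoments.psi_mul_psi
    (τ := τ) (u := u) (a := a) m n).integrable
  rw [Measure.comp_eq_comp_const_apply] at hint ⊢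
  rw [Kernel.integral_comp hint, Kernel.const_apply]
  have : ∀ᵐ ξ ∂φ, ∫ z, psi τ u a m z.1 * psi τ u a n z.2 ∂κ ξ =
      if m = n then (∏ j, ξ j ^ n j) * multiFact n else 0 := by
    filter_upwards [hpair, hφ.mem_Icc] with ξ hξ hc
    -- A normal pair is determined by its covariances, so Mehler's formula applies to `κ ξ`.
    rw [hξ.unique (isNormalPair_pairLaw hτ hu hc), integral_psi_pairLaw hτ hu hc]
  rw [integral_congr_ae this]
  split_ifs
  · rw [integral_mul_const]
  · simp

lemma isConditionallyNormal_bind (hτ : ∀ i, 0 < τ i)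
    (hu : IsOrthogonalBasis (prob τ) u a) {φ : Measure (Fin d → ℝ)} (hφ : IsCubeLaw φ) :
    IsConditionallyNormal τ u a φ (φ.bind (pairKernel τ u a)) := by
  refine ⟨pairKernel τ u a, inferInstance, ?_, rfl⟩
  filter_upwards [hφ.mem_Icc] with ξ hξ
  rw [pairKernel_apply]
  exact isNormalPair_pairLaw hτ hu hξ

lemma hasExpansion_of_isConditionallyNormal (hτ : ∀ i, 0 < τ i)
    (hu : IsOrthogonalBasis (prob τ) u a) {ρ : (Fin d → ℕ) → ℝ} {φ : Measure (Fin d → ℝ)}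
    (hφ : IsCubeLaw φ) (hm : HasMoments φ ρ) {μ : Measure ((Fin d → ℝ) × (Fin d → ℝ))}
    (h : IsConditionallyNormal τ u a φ μ) : HasExpansion τ u a ρ μ := by
  obtain ⟨_, h1, h2, h3⟩ := h.properties hτ hu hφ
  rw [← funext hm] at h3
  exact h3.hasExpansion hτ hu h1 h2

/-- Forward, `μ` and the explicit mixture over `φ` share their Hermite moments, hence coincide.
Backward, the diagonal moments are computed in two ways. -/
lemma hasMoments_iff_isConditionallyNormal (hτ : ∀ i, 0 < τ i)
    (hu : IsOrthogonalBasis (prob τ) u a) {ρ : (Fin d → ℕ) → ℝ}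
    {μ : Measure ((Fin d → ℝ) × (Fin d → ℝ))} [IsProbabilityMeasure μ]
    (hμ : HasExpansion τ u a ρ μ) {φ : Measure (Fin d → ℝ)} (hφ : IsCubeLaw φ) :
    HasMoments φ ρ ↔ IsConditionallyNormal τ u a φ μ := by
  constructor
  · intro hm
    have hc := isConditionallyNormal_bind hτ hu hφ
    obtain ⟨_, h1, h2, h3⟩ := hc.properties hτ hu hφ
    rw [← funext hm] at h3
    have := HasPsiMoments.unique hτ hu (hasExpMoments_of_marginals hμ.fst_eq hμ.snd_eq)
      (hasExpMoments_of_marginals h1 h2) (hμ.hasPsiMoments hτ hu) h3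
    rwa [this]
  · intro hc n
    obtain ⟨_, h1, h2, h3⟩ := hc.properties hτ hu hφ
    have e1 := hμ.hasPsiMoments hτ hu n n
    have e2 := h3 n n
    rw [if_pos rfl] at e1 e2
    exact mul_right_cancel₀ (multiFact_pos n).ne' (e1.symm.trans e2)

end Expansion

/-! ### Non-negative expansions and their moment representation. -/

section Nonneg

variable {d : ℕ} {τ : Fin d → ℝ} {u : Fin d → Fin d → ℝ} {a : Fin d → ℝ}

lemma pairMoments_prod (τ : Fin d → ℝ) : PairMoments ((normalLaw τ).prod (normalLaw τ)) :=
  (IsGaussian.hasExpMoments _).pairMoments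

open MvPolynomial

/-- The `j`-th coordinate of `whiten` as a polynomial in the variables `v`. -/
noncomputable def whitenPoly (τ : Fin d → ℝ) (u : Fin d → Fin d → ℝ) (a : Fin d → ℝ)
    (v : Fin d → Fin d ⊕ Fin d) (j : Fin d) : MvPolynomial (Fin d ⊕ Fin d) ℝ :=
  ∑ i, C (u j i / scale τ a j) * X (v i)

lemma eval_whitenPoly (v : Fin d → Fin d ⊕ Fin d) (j : Fin d) (s : Fin d ⊕ Fin d → ℝ) :
    eval s (whitenPoly τ u a v j) = whiten τ u a (fun i => s (v i)) j := by
  simp [whitenPoly, whiten]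

/-- The Hermite coefficient of index `k` of the monomial of multi-degree `α`. -/
noncomputable def monomialCoeff (α k : Fin d → ℕ) : ℝ :=
  ∏ j, ∫ x, x ^ α j * (herm (k j)).eval x ∂stdGauss

lemma monomialCoeff_self (n : Fin d → ℕ) : monomialCoeff n n = multiFact n := by
  simp only [monomialCoeff, integral_pow_mul_herm_self, multiFact]

lemma monomialCoeff_eq_zero {n k : Fin d → ℕ} (h : ¬ k ≤ n) : monomialCoeff n k = 0 := by
  obtain ⟨j, hj⟩ := not_forall.1 h
  exact Finset.prod_eq_zero (Finset.mem_univ j) (integral_pow_mul_herm_of_lt (not_le.1 hj))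

/-- In each coordinate the limit is the coefficient of `x ^ n_j` in a monic polynomial of degree
`k_j ≤ n_j`. -/
lemma tendsto_monomialCoeff {n k : Fin d → ℕ} (h : k ≤ n) :
    Tendsto (fun K => monomialCoeff (fun j => 2 * K - n j) k / gaussMoment (2 * K) ^ d) atTop
      (𝓝 (if k = n then 1 else 0)) := by
  have h1 := tendsto_finsetProd (Finset.univ : Finset (Fin d)) fun j _ =>
    tendsto_integral_pow_mul_div (n := n j) (p := herm (k j)) (by rw [natDegree_herm]; exact h j)
  have e : (if k = n then (1 : ℝ) else 0) = ∏ j, (herm (k j)).coeff (n j) := by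
    have := prod_ite_eq_funext k n fun _ => (1 : ℝ)
    rw [Finset.prod_const_one] at this
    rw [← this]
    refine Finset.prod_congr rfl fun j _ => ?_
    split_ifs with hj
    · rw [hj, coeff_herm_self]
    · rw [Polynomial.coeff_eq_zero_of_natDegree_lt]
      rw [natDegree_herm]
      exact lt_of_le_of_ne (h j) hj
  rw [e]
  refine h1.congr fun K => ?_
  rw [Finset.prod_div_distrib, monomialCoeff]
  simp

/-- Off the coordinate hyperplanes the sum is `∏ x_j ^ (2K) · r(y / x)`. On them every term
vanishes, because the strict inequality in `hK` keeps all exponents of `x` positive. -/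
lemma homogenization_nonneg {r : MvPolynomial (Fin d) ℝ} (hr : ∀ t, 0 ≤ eval t r) {K : ℕ}
    (hK : ∀ n ∈ r.support, ∀ j, n j < 2 * K) (x y : Fin d → ℝ) :
    0 ≤ ∑ n ∈ r.support, coeff n r * ((∏ j, x j ^ (2 * K - n j)) * ∏ j, y j ^ n j) := by
  by_cases hx : ∃ j, x j = 0
  · obtain ⟨j, hj⟩ := hx
    refine (Finset.sum_eq_zero fun n hn => ?_).ge
    rw [Finset.prod_eq_zero (Finset.mem_univ j), zero_mul, mul_zero]
    rw [hj, zero_pow]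
    have := hK n hn j
    omega
  · push Not at hx
    have e : ∑ n ∈ r.support, coeff n r * ((∏ j, x j ^ (2 * K - n j)) * ∏ j, y j ^ n j) =
        (∏ j, x j ^ (2 * K)) * eval (fun j => y j / x j) r := by
      rw [eval_eq', Finset.mul_sum]
      refine Finset.sum_congr rfl fun n hn => ?_
      rw [mul_left_comm (∏ j, x j ^ (2 * K)), ← Finset.prod_mul_distrib, ← Finset.prod_mul_distrib]
      congr 1
      refine Finset.prod_congr rfl fun j _ => ?_
      rw [div_pow, pow_sub₀ _ (hx j) (hK n hn j).le]
      ring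
    rw [e]
    exact mul_nonneg (Finset.prod_nonneg fun j _ => by rw [pow_mul]; positivity) (hr _)

variable [NeZero d]

lemma hasAllMoments_term (hτ : ∀ i, 0 < τ i) (hu : IsOrthogonalBasis (prob τ) u a)
    (ρ : (Fin d → ℕ) → ℝ) (k : Fin d → ℕ) :
    HasAllMoments ((normalLaw τ).prod (normalLaw τ)) (term τ u a ρ k) := by
  have := (HasAllMoments.const (ρ k / multiFact k)).mul
    ((pairMoments_prod τ).psi_mul_psi (τ := τ) (u := u) (a := a) k k)
  simpa only [← term_eq hτ hu] using this

lemma integral_mul_term (hτ : ∀ i, 0 < τ i) (hu : IsOrthogonalBasis (prob τ) u a)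
    (ρ : (Fin d → ℕ) → ℝ) (f g : (Fin d → ℝ) → ℝ) (k : Fin d → ℕ) :
    ∫ z, (f z.1 * g z.2) * term τ u a ρ k z ∂((normalLaw τ).prod (normalLaw τ)) =
      ρ k / multiFact k * ((∫ x, f x * psi τ u a k x ∂normalLaw τ) *
        ∫ x, g x * psi τ u a k x ∂normalLaw τ) := by
  rw [← integral_prod_mul, ← integral_const_mul]
  congr 1
  ext1 z
  rw [term_eq hτ hu]; ring

lemma hasSum_psi_mul_term (hτ : ∀ i, 0 < τ i) (hu : IsOrthogonalBasis (prob τ) u a)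
    (ρ : (Fin d → ℕ) → ℝ) (m n : Fin d → ℕ) :
    HasSum (fun k => ∫ z, (psi τ u a m z.1 * psi τ u a n z.2) * term τ u a ρ k z
      ∂((normalLaw τ).prod (normalLaw τ))) (if m = n then ρ n * multiFact n else 0) := by
  have e : (if m = n then ρ n * multiFact n else 0) =
      ∫ z, (psi τ u a m z.1 * psi τ u a n z.2) * term τ u a ρ n z
        ∂((normalLaw τ).prod (normalLaw τ)) := by
    rw [integral_mul_term hτ hu, integral_psi_mul_psi hτ hu, integral_psi_mul_psi hτ hu]
    have := (multiFact_pos n).ne'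
    by_cases hmn : m = n
    · simp only [hmn, if_true]
      field_simp
    · simp [hmn]
  rw [e]
  refine hasSum_single n fun k hk => ?_
  rw [integral_mul_term hτ hu, integral_psi_mul_psi hτ hu n k, if_neg hk.symm]
  simp

/-- Term-by-term integration of a polynomial against the expansion is its integral under `μ`: this
holds for the products `ψ_m(x) ψ_n(y)` and extends by linearity. -/
lemma HasPsiMoments.expansionNonneg (hτ : ∀ i, 0 < τ i) (hu : IsOrthogonalBasis (prob τ) u a)
    {ρ : (Fin d → ℕ) → ℝ} {μ : Measure ((Fin d → ℝ) × (Fin d → ℝ))} [IsFiniteMeasure μ]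
    (hμ : HasExpMoments μ) (h : HasPsiMoments τ u a ρ μ) : ExpansionNonneg τ u a ρ := by
  have key (f : (Fin d → ℝ) × (Fin d → ℝ) → ℝ) (hf : f ∈ Submodule.span ℝ
      (Set.range fun (p : (Fin d → ℕ) × (Fin d → ℕ)) (z : (Fin d → ℝ) × (Fin d → ℝ)) =>
        psi τ u a p.1 z.1 * psi τ u a p.2 z.2)) :
      HasAllMoments ((normalLaw τ).prod (normalLaw τ)) f ∧ Integrable f μ ∧
      HasSum (fun k => ∫ z, f z * term τ u a ρ k z ∂((normalLaw τ).prod (normalLaw τ)))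
        (∫ z, f z ∂μ) := by
    induction hf using Submodule.span_induction with
    | mem f hf =>
      obtain ⟨⟨m, n⟩, rfl⟩ := hf
      refine ⟨(pairMoments_prod τ).psi_mul_psi m n, (hμ.pairMoments.psi_mul_psi m n).integrable, ?_⟩
      simp only [h m n]
      exact hasSum_psi_mul_term hτ hu ρ m n
    | zero =>
      refine ⟨HasAllMoments.const 0, by simp, by simp⟩
    | add f g _ _ hf hg =>
      refine ⟨hf.1.add hg.1, hf.2.1.add hg.2.1, ?_⟩
      simp only [Pi.add_apply]
      rw [integral_add hf.2.1 hg.2.1]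
      convert hf.2.2.add hg.2.2 using 2 with k
      rw [← integral_add (hf.1.mul (hasAllMoments_term hτ hu ρ k)).integrable
        (hg.1.mul (hasAllMoments_term hτ hu ρ k)).integrable]
      simp only [add_mul]
    | smul c f _ hf =>
      refine ⟨(HasAllMoments.const c).mul hf.1, hf.2.1.smul c, ?_⟩
      simp only [Pi.smul_apply, smul_eq_mul, mul_assoc, integral_const_mul]
      exact hf.2.2.mul_left c
  intro q hq
  rw [(key _ (eval_mem_span_psi hτ hu q)).2.2.tsum_eq]
  exact integral_nonneg fun z => hq z.1 z.2

/-- Testing against `(ψ_n(x) - ψ_n(y))²` gives `2 n! (1 - ρ_n) ≥ 0`. -/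
lemma ExpansionNonneg.le_one (hτ : ∀ i, 0 < τ i) (hu : IsOrthogonalBasis (prob τ) u a)
    {ρ : (Fin d → ℕ) → ℝ} (hρ : ρ 0 = 1) (h : ExpansionNonneg τ u a ρ) (n : Fin d → ℕ) :
    ρ n ≤ 1 := by
  let P (v : Fin d → Fin d ⊕ Fin d) : MvPolynomial (Fin d ⊕ Fin d) ℝ :=
    ∏ j, Polynomial.aeval (whitenPoly τ u a v j) (herm (n j))
  have hP (v : Fin d → Fin d ⊕ Fin d) (s : Fin d ⊕ Fin d → ℝ) :
      eval s (P v) = psi τ u a n fun i => s (v i) := by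
    simp only [P, map_prod, psi, herms]
    refine Finset.prod_congr rfl fun j _ => ?_
    rw [← eval_whitenPoly, ← coe_aeval_eq_eval, RingHom.coe_coe, ← Polynomial.aeval_algHom_apply,
      Polynomial.coe_aeval_eq_eval]
  have hq := h ((P Sum.inl - P Sum.inr) ^ 2) fun x y => by
    rw [map_pow]; positivity
  simp only [map_pow, map_sub, hP, Sum.elim_inl, Sum.elim_inr] at hq
  have hpm := pairMoments_prod τ
  have hone (k : Fin d → ℕ) : ∫ x, 1 * psi τ u a k x ∂normalLaw τ = if k = 0 then 1 else 0 := by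
    have := integral_psi_mul_psi hτ hu 0 k
    simp only [psi_zero] at this
    rw [this]
    simp only [eq_comm (a := k)]
    split_ifs with hk
    · subst hk; simp [multiFact]
    · rfl
  have hsq : ∫ x, psi τ u a n x ^ 2 * psi τ u a 0 x ∂normalLaw τ = multiFact n := by
    simp only [psi_zero, mul_one, sq]
    rw [integral_psi_mul_psi hτ hu, if_pos rfl]
  -- A function of one variable alone meets only the term `k = 0`, since `ψ_k` of the other variable
  -- integrates to zero otherwise; here `ρ 0 = 1` enters.
  have s1 : HasSum (fun k => ∫ z, (psi τ u a n z.1 ^ 2 * 1) * term τ u a ρ k z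
      ∂((normalLaw τ).prod (normalLaw τ))) (multiFact n) := by
    have e := integral_mul_term hτ hu ρ (fun x => psi τ u a n x ^ 2) (fun _ => 1)
    simp only [e, hone]
    convert hasSum_single (0 : Fin d → ℕ) fun k hk => ?_ using 1
    · rw [if_pos rfl, hsq, hρ]; simp [multiFact]
    · simp [hk]
  have s2 : HasSum (fun k => ∫ z, (1 * psi τ u a n z.2 ^ 2) * term τ u a ρ k z
      ∂((normalLaw τ).prod (normalLaw τ))) (multiFact n) := by
    have e := integral_mul_term hτ hu ρ (fun _ => 1) (fun x => psi τ u a n x ^ 2)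
    simp only [e, hone]
    convert hasSum_single (0 : Fin d → ℕ) fun k hk => ?_ using 1
    · rw [if_pos rfl, hsq, hρ]; simp [multiFact]
    · simp [hk]
  have s3 := hasSum_psi_mul_term hτ hu ρ n n
  rw [if_pos rfl] at s3
  have hs := (s1.add s2).sub (s3.mul_left 2)
  have e (k : Fin d → ℕ) : ∫ z, (psi τ u a n z.1 - psi τ u a n z.2) ^ 2 * term τ u a ρ k z
      ∂((normalLaw τ).prod (normalLaw τ)) =
      ∫ z, (psi τ u a n z.1 ^ 2 * 1) * term τ u a ρ k z ∂((normalLaw τ).prod (normalLaw τ)) +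
      ∫ z, (1 * psi τ u a n z.2 ^ 2) * term τ u a ρ k z ∂((normalLaw τ).prod (normalLaw τ)) -
      2 * ∫ z, (psi τ u a n z.1 * psi τ u a n z.2) * term τ u a ρ k z
        ∂((normalLaw τ).prod (normalLaw τ)) := by
    have ht := hasAllMoments_term hτ hu ρ k
    have i1 : Integrable (fun z => (psi τ u a n z.1 ^ 2 * 1) * term τ u a ρ k z)
        ((normalLaw τ).prod (normalLaw τ)) :=
      ((((hpm.herms_fst (whiten τ u a) n).pow 2).mul (HasAllMoments.const 1)).mul ht).integrable
    have i2 : Integrable (fun z => (1 * psi τ u a n z.2 ^ 2) * term τ u a ρ k z)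
        ((normalLaw τ).prod (normalLaw τ)) :=
      (((HasAllMoments.const 1).mul ((hpm.herms_snd (whiten τ u a) n).pow 2)).mul ht).integrable
    have i3 : Integrable (fun z => (psi τ u a n z.1 * psi τ u a n z.2) * term τ u a ρ k z)
        ((normalLaw τ).prod (normalLaw τ)) := ((hpm.psi_mul_psi n n).mul ht).integrable
    have i12 : Integrable (fun z => (psi τ u a n z.1 ^ 2 * 1) * term τ u a ρ k z +
        (1 * psi τ u a n z.2 ^ 2) * term τ u a ρ k z) ((normalLaw τ).prod (normalLaw τ)) :=
      i1.add i2
    rw [← integral_const_mul, ← integral_add i1 i2, ← integral_sub i12 (i3.const_mul 2)]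
    congr 1
    ext1 z
    ring
  simp only [e] at hq
  rw [hs.tsum_eq] at hq
  have := multiFact_pos n
  nlinarith

lemma integral_monomial_mul_psi (hτ : ∀ i, 0 < τ i) (hu : IsOrthogonalBasis (prob τ) u a)
    (α k : Fin d → ℕ) :
    ∫ x, (∏ j, whiten τ u a x j ^ α j) * psi τ u a k x ∂normalLaw τ = monomialCoeff α k := by
  rw [monomialCoeff, ← integral_stdLaw_prod fun j x => x ^ α j * (herm (k j)).eval x,
    ← integral_comp_whiten hτ hu (by fun_prop)]
  simp only [psi, herms, Finset.prod_mul_distrib]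

/-- The test polynomial is the homogenization `∏ x_j ^ (2K) · r(y / x)` in whitened coordinates. Its
integral `S K`, divided by `gaussMoment (2 * K) ^ d`, tends to `∑ r_n ρ_n`: among the indices `k ≤
n` only `k = n` survives the limit. -/
lemma ExpansionNonneg.momentFunctional_nonneg (hτ : ∀ i, 0 < τ i)
    (hu : IsOrthogonalBasis (prob τ) u a) {ρ : (Fin d → ℕ) → ℝ} (h : ExpansionNonneg τ u a ρ)
    (r : MvPolynomial (Fin d) ℝ) (hr : ∀ t, 0 ≤ eval t r) : 0 ≤ momentFunctional ρ r := by
  let box (n : Fin d → ℕ) : Finset (Fin d → ℕ) := Fintype.piFinset fun j => Finset.range (n j + 1)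
  have hbox (n k : Fin d → ℕ) : k ∈ box n ↔ k ≤ n := by
    simp [box, Fintype.mem_piFinset, Pi.le_def]
  let S (K : ℕ) : ℝ := ∑ n ∈ r.support, coeff n r * ∑ k ∈ box n,
    ρ k / multiFact k * (monomialCoeff (fun j => 2 * K - n j) k * monomialCoeff n k)
  have hS (K : ℕ) (hK : ∀ n ∈ r.support, ∀ j, n j < 2 * K) : 0 ≤ S K := by
    have hq := h (∑ n ∈ r.support, C (coeff n r) *
      ((∏ j, whitenPoly τ u a Sum.inl j ^ (2 * K - n j)) *
        ∏ j, whitenPoly τ u a Sum.inr j ^ n j))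
    simp only [map_sum, map_mul, map_prod, map_pow, eval_C, eval_whitenPoly, Sum.elim_inl,
      Sum.elim_inr] at hq
    specialize hq fun x y => homogenization_nonneg hr hK _ _
    have hs (n : Fin d →₀ ℕ) : HasSum (fun k => ∫ z, ((∏ j, whiten τ u a z.1 j ^ (2 * K - n j)) *
        ∏ j, whiten τ u a z.2 j ^ n j) * term τ u a ρ k z ∂((normalLaw τ).prod (normalLaw τ)))
        (∑ k ∈ box n, ρ k / multiFact k *
          (monomialCoeff (fun j => 2 * K - n j) k * monomialCoeff n k)) := by
      have e (k : Fin d → ℕ) := integral_mul_term hτ hu ρ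
        (fun x => ∏ j, whiten τ u a x j ^ (2 * K - n j)) (fun x => ∏ j, whiten τ u a x j ^ n j) k
      simp only [e, integral_monomial_mul_psi hτ hu]
      -- The monomial in `y` has degree `n`, so only `k ≤ n` contributes: a finite range that does
      -- not depend on `K`.
      refine hasSum_sum_of_ne_finset_zero fun k hk => ?_
      rw [hbox] at hk
      rw [monomialCoeff_eq_zero hk, mul_zero, mul_zero]
    have hsum := hasSum_sum (s := r.support) fun n _ => (hs n).mul_left (coeff n r)
    have e (k : Fin d → ℕ) : ∫ z, (∑ n ∈ r.support, coeff n r *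
        ((∏ j, whiten τ u a z.1 j ^ (2 * K - n j)) * ∏ j, whiten τ u a z.2 j ^ n j)) *
          term τ u a ρ k z ∂((normalLaw τ).prod (normalLaw τ)) =
        ∑ n ∈ r.support, coeff n r * ∫ z, ((∏ j, whiten τ u a z.1 j ^ (2 * K - n j)) *
        ∏ j, whiten τ u a z.2 j ^ n j) * term τ u a ρ k z ∂((normalLaw τ).prod (normalLaw τ)) := by
      simp only [Finset.sum_mul, mul_assoc (coeff _ r)]
      rw [integral_finsetSum]
      · simp only [integral_const_mul]
      · intro n _
        have hpm := pairMoments_prod τ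
        have c1 (j : Fin d) := hpm.eval (whitenPoly τ u a Sum.inl j)
        have c2 (j : Fin d) := hpm.eval (whitenPoly τ u a Sum.inr j)
        simp only [eval_whitenPoly, Sum.elim_inl, Sum.elim_inr] at c1 c2
        exact ((HasAllMoments.const (coeff n r)).mul
          (((HasAllMoments.prod Finset.univ fun j => (c1 j).pow (2 * K - n j)).mul
          (HasAllMoments.prod Finset.univ fun j => (c2 j).pow (n j))).mul
          (hasAllMoments_term hτ hu ρ k))).integrable
    simp only [e] at hq
    rwa [hsum.tsum_eq] at hq
  have hlim : Tendsto (fun K => S K / gaussMoment (2 * K) ^ d) atTop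
      (𝓝 (∑ n ∈ r.support, coeff n r * ∑ k ∈ box n,
        ρ k / multiFact k * ((if k = n then 1 else 0) * monomialCoeff n k))) := by
    have h1 := tendsto_finsetSum r.support fun n _ => (tendsto_finsetSum (box n) fun k hk =>
      ((tendsto_monomialCoeff ((hbox n k).1 hk)).mul_const (monomialCoeff n k)).const_mul
        (ρ k / multiFact k)).const_mul (coeff n r)
    refine h1.congr fun K => ?_
    simp only [S, Finset.sum_div, Finset.mul_sum]
    refine Finset.sum_congr rfl fun n _ => Finset.sum_congr rfl fun k _ => ?_
    ring
  have e : ∑ n ∈ r.support, coeff n r * ∑ k ∈ box n,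
      ρ k / multiFact k * ((if k = n then 1 else 0) * monomialCoeff n k) =
      momentFunctional ρ r := by
    rw [momentFunctional_apply]
    refine Finset.sum_congr rfl fun n _ => ?_
    rw [Finset.sum_eq_single (n : Fin d → ℕ)]
    · rw [if_pos rfl, monomialCoeff_self, one_mul, div_mul_cancel₀ _ (multiFact_pos _).ne']
    · intro k _ hk
      rw [if_neg hk]; simp
    · intro hk
      exact absurd ((hbox n n).2 le_rfl) hk
  rw [e] at hlim
  refine ge_of_tendsto hlim ?_
  -- Beyond the total degree of `r`, every exponent satisfies `n j < 2 * K`, as homogenization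
  -- requires.
  filter_upwards [eventually_gt_atTop (r.support.sup fun n => ∑ j, n j)] with K hK
  refine div_nonneg (hS K fun n hn j => ?_) (pow_nonneg (gaussMoment_even_pos K).le _)
  have h1 : ∑ j, n j ≤ r.support.sup fun n => ∑ j, n j :=
    Finset.le_sup (f := fun n : Fin d →₀ ℕ => ∑ j, n j) hn
  have h2 : n j ≤ ∑ j, n j := Finset.single_le_sum (fun _ _ => Nat.zero_le _) (Finset.mem_univ j)
  omega

theorem expansionNonneg_iff_exists_cubeLaw (hτ : ∀ i, 0 < τ i)
    (hu : IsOrthogonalBasis (prob τ) u a) {ρ : (Fin d → ℕ) → ℝ} (hρ : ρ 0 = 1) :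
    ExpansionNonneg τ u a ρ ↔ ∃ φ, IsCubeLaw φ ∧ HasMoments φ ρ := by
  constructor
  · intro h
    exact exists_cubeLaw hρ (h.momentFunctional_nonneg hτ hu) fun j k => h.le_one hτ hu hρ _
  · rintro ⟨φ, hφ, hm⟩
    obtain ⟨_, h1, h2, h3⟩ := (isConditionallyNormal_bind hτ hu hφ).properties hτ hu hφ
    rw [← funext hm] at h3
    exact h3.expansionNonneg hτ hu (hasExpMoments_of_marginals h1 h2)

theorem expansionNonneg_iff_exists_hasExpansion (hτ : ∀ i, 0 < τ i)
    (hu : IsOrthogonalBasis (prob τ) u a) {ρ : (Fin d → ℕ) → ℝ} (hρ : ρ 0 = 1) :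
    ExpansionNonneg τ u a ρ ↔ ∃ μ, IsProbabilityMeasure μ ∧ HasExpansion τ u a ρ μ := by
  constructor
  · intro h
    obtain ⟨φ, hφ, hm⟩ := (expansionNonneg_iff_exists_cubeLaw hτ hu hρ).1 h
    have hc := isConditionallyNormal_bind hτ hu hφ
    exact ⟨_, (hc.properties hτ hu hφ).1, hasExpansion_of_isConditionallyNormal hτ hu hφ hm hc⟩
  · rintro ⟨μ, _, h⟩
    exact (h.hasPsiMoments hτ hu).expansionNonneg hτ hu
      (hasExpMoments_of_marginals h.fst_eq h.snd_eq)

end Nonneg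

/-! ### Measures with a square-integrable density. -/

section Density

variable {E : Type*} [MeasurableSpace E] {G : Measure E} {k : E → ℝ}

lemma isFiniteMeasure_withDensity_of_memLp [IsFiniteMeasure G] (hk : MemLp k 2 G) :
    IsFiniteMeasure (G.withDensity fun z => ENNReal.ofReal (k z)) :=
  isFiniteMeasure_withDensity_ofReal (hk.integrable one_le_two).2

lemma integrable_withDensity_of_memLp (hk : MemLp k 2 G) {f : E → ℝ} (hf : MemLp f 2 G) :
    Integrable f (G.withDensity fun z => ENNReal.ofReal (k z)) := by
  rw [integrable_withDensity_iff_integrable_smul₀' hk.1.aemeasurable.ennreal_ofReal (by simp)]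
  simp only [ENNReal.toReal_ofReal', smul_eq_mul]
  have hp : MemLp (fun z => max (k z) 0) 2 G := hk.pos_part
  exact hp.integrable_mul hf

lemma integral_withDensity_ofReal (hk : MemLp k 2 G) (f : E → ℝ) :
    ∫ z, f z ∂(G.withDensity fun z => ENNReal.ofReal (k z)) = ∫ z, f z * max (k z) 0 ∂G := by
  rw [integral_withDensity_eq_integral_toReal_smul₀ hk.1.aemeasurable.ennreal_ofReal (by simp)]
  simp only [ENNReal.toReal_ofReal', smul_eq_mul, mul_comm]

lemma HasExpMoments.withDensity [NormedAddCommGroup E] [NormedSpace ℝ E] [BorelSpace E]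
    (hG : HasExpMoments G) (hk : MemLp k 2 G) :
    HasExpMoments (G.withDensity fun z => ENNReal.ofReal (k z)) := by
  intro L
  refine integrable_withDensity_of_memLp hk ((memLp_two_iff_integrable_sq (by fun_prop)).2 ?_)
  refine (hG ((2 : ℝ) • L)).congr (ae_of_all _ fun z => ?_)
  simp only [smul_apply, smul_eq_mul, abs_mul, abs_two, ← Real.exp_nat_mul, Nat.cast_ofNat]

/-- The two densities are the negative and positive parts of `k`, which are never both positive;
hence `k⁻ ≤ k⁺` forces `k⁻ = 0`. -/
lemma ae_nonneg_of_withDensity_le [IsFiniteMeasure G] (hk : MemLp k 2 G)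
    (h : (G.withDensity fun z => ENNReal.ofReal (-k z)) ≤
      G.withDensity fun z => ENNReal.ofReal (k z)) : ∀ᵐ z ∂G, 0 ≤ k z := by
  have hle : (fun z => ENNReal.ofReal (-k z)) ≤ᵐ[G] fun z => ENNReal.ofReal (k z) := by
    refine ae_le_of_forall_setLIntegral_le_of_sigmaFinite₀
      hk.1.aemeasurable.neg.ennreal_ofReal fun s hs _ => ?_
    rw [← withDensity_apply _ hs, ← withDensity_apply _ hs]
    exact h s
  filter_upwards [hle] with z hz
  by_contra! hc
  rw [ENNReal.ofReal_of_nonpos hc.le] at hz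
  have := ENNReal.ofReal_eq_zero.1 (le_antisymm hz bot_le)
  linarith

end Density

/-! ### Mean square convergence and non-negativity of the sum. -/

section MeanSquare

variable {d : ℕ} {τ : Fin d → ℝ} {u : Fin d → Fin d → ℝ} {a : Fin d → ℝ}

lemma memLp_psi_pair (n : Fin d → ℕ) : MemLp (fun z : (Fin d → ℝ) × (Fin d → ℝ) =>
    (multiFact n)⁻¹ * (psi τ u a n z.1 * psi τ u a n z.2)) 2
      ((normalLaw τ).prod (normalLaw τ)) :=
  ((HasAllMoments.const _).mul ((pairMoments_prod τ).psi_mul_psi n n)).memLp_two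

/-- The orthonormal family of the normalized diagonal Hermite products. -/
noncomputable def diagFamily (τ : Fin d → ℝ) (u : Fin d → Fin d → ℝ) (a : Fin d → ℝ)
    (n : Fin d → ℕ) : Lp ℝ 2 ((normalLaw τ).prod (normalLaw τ)) :=
  (memLp_psi_pair (u := u) (a := a) n).toLp

variable [NeZero d]

lemma orthonormal_diagFamily (hτ : ∀ i, 0 < τ i) (hu : IsOrthogonalBasis (prob τ) u a) :
    Orthonormal ℝ (diagFamily τ u a) := by
  rw [orthonormal_iff_ite]
  intro m n
  rw [L2.inner_def]
  have e : ∀ᵐ z ∂((normalLaw τ).prod (normalLaw τ)),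
      inner ℝ (diagFamily τ u a m z) (diagFamily τ u a n z) =
      ((multiFact m)⁻¹ * (multiFact n)⁻¹) * ((psi τ u a m z.1 * psi τ u a n z.1) *
        (psi τ u a m z.2 * psi τ u a n z.2)) := by
    filter_upwards [(memLp_psi_pair (u := u) (a := a) (τ := τ) m).coeFn_toLp,
      (memLp_psi_pair (u := u) (a := a) (τ := τ) n).coeFn_toLp] with z h1 h2
    rw [diagFamily, diagFamily, h1, h2]
    simp only [RCLike.inner_apply, conj_trivial]
    ring
  rw [integral_congr_ae e, integral_const_mul,
    integral_prod_mul (fun x => psi τ u a m x * psi τ u a n x)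
      (fun x => psi τ u a m x * psi τ u a n x), integral_psi_mul_psi hτ hu]
  by_cases h : m = n
  · subst h
    have := (multiFact_pos m).ne'
    simp only [if_true]
    field_simp
  · simp [h]

lemma isL2Sum_iff_hasSum (hτ : ∀ i, 0 < τ i) (hu : IsOrthogonalBasis (prob τ) u a)
    {ρ : (Fin d → ℕ) → ℝ} {k : (Fin d → ℝ) × (Fin d → ℝ) → ℝ}
    (hk : MemLp k 2 ((normalLaw τ).prod (normalLaw τ))) :
    IsL2Sum τ u a ρ k ↔ HasSum (fun n => ρ n • diagFamily τ u a n) hk.toLp := by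
  have e (s : Finset (Fin d → ℕ)) :
      eLpNorm (fun z => k z - ∑ n ∈ s, term τ u a ρ n z) 2 ((normalLaw τ).prod (normalLaw τ)) =
      eLpNorm (⇑(∑ n ∈ s, ρ n • diagFamily τ u a n) - ⇑hk.toLp) 2
        ((normalLaw τ).prod (normalLaw τ)) := by
    rw [eLpNorm_sub_comm]
    refine eLpNorm_congr_ae ?_
    have h1 : ∀ᵐ z ∂((normalLaw τ).prod (normalLaw τ)),
        (∑ n ∈ s, ρ n • diagFamily τ u a n : Lp ℝ 2 ((normalLaw τ).prod (normalLaw τ))) z =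
          ∑ n ∈ s, term τ u a ρ n z := by
      have h3 : ∀ᵐ z ∂((normalLaw τ).prod (normalLaw τ)), ∀ n ∈ s,
          (ρ n • diagFamily τ u a n : Lp ℝ 2 ((normalLaw τ).prod (normalLaw τ))) z =
            term τ u a ρ n z := by
        refine (ae_ball_iff s.countable_toSet).2 fun n _ => ?_
        filter_upwards [Lp.coeFn_smul (ρ n) (diagFamily τ u a n),
          (memLp_psi_pair (u := u) (a := a) (τ := τ) n).coeFn_toLp] with z h1 h2
        rw [h1, Pi.smul_apply, diagFamily, h2, term_eq hτ hu, smul_eq_mul]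
        ring
      filter_upwards [Lp.coeFn_finsetSum s fun n => ρ n • diagFamily τ u a n, h3] with z h1 h2
      rw [h1, Finset.sum_apply]
      exact Finset.sum_congr rfl fun n hn => h2 n hn
    filter_upwards [h1, hk.coeFn_toLp] with z h1 h2
    simp only [Pi.sub_apply, h1, h2]
  rw [IsL2Sum, HasSum, Lp.tendsto_Lp_iff_tendsto_eLpNorm']
  simp only [e, hk, true_and]
  rfl

theorem summable_sq_iff_exists_isL2Sum (hτ : ∀ i, 0 < τ i)
    (hu : IsOrthogonalBasis (prob τ) u a) (ρ : (Fin d → ℕ) → ℝ) :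
    (Summable fun n => ρ n ^ 2) ↔ ∃ k, IsL2Sum τ u a ρ k := by
  have h := (orthonormal_diagFamily hτ hu).orthogonalFamily.summable_iff_norm_sq_summable ρ
  simp only [LinearIsometry.toSpanSingleton_apply, Real.norm_eq_abs, sq_abs] at h
  rw [← h]
  constructor
  · rintro ⟨k, hk⟩
    refine ⟨k, (isL2Sum_iff_hasSum hτ hu (Lp.memLp k)).2 ?_⟩
    rwa [Lp.toLp_coeFn]
  · rintro ⟨k, hk⟩
    exact ((isL2Sum_iff_hasSum hτ hu hk.1).1 hk).summable

/-- Pairing with `f` is a continuous functional on `L²`, so it commutes with the sum. -/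
lemma IsL2Sum.hasSum_integral (hτ : ∀ i, 0 < τ i) (hu : IsOrthogonalBasis (prob τ) u a)
    {ρ : (Fin d → ℕ) → ℝ} {k : (Fin d → ℝ) × (Fin d → ℝ) → ℝ} (hk : IsL2Sum τ u a ρ k)
    {f : (Fin d → ℝ) × (Fin d → ℝ) → ℝ} (hf : MemLp f 2 ((normalLaw τ).prod (normalLaw τ))) :
    HasSum (fun n => ∫ z, f z * term τ u a ρ n z ∂((normalLaw τ).prod (normalLaw τ)))
      (∫ z, f z * k z ∂((normalLaw τ).prod (normalLaw τ))) := by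
  have h := ((isL2Sum_iff_hasSum hτ hu hk.1).1 hk).mapL (innerSL ℝ (MemLp.toLp f hf))
  simp only [innerSL_apply_apply, L2.inner_def] at h
  have e1 : ∫ z, inner ℝ ((MemLp.toLp f hf : Lp ℝ 2 _) z) ((MemLp.toLp k hk.1 : Lp ℝ 2 _) z) ∂((normalLaw τ).prod (normalLaw τ)) =
      ∫ z, f z * k z ∂((normalLaw τ).prod (normalLaw τ)) := by
    refine integral_congr_ae ?_
    filter_upwards [hf.coeFn_toLp, hk.1.coeFn_toLp] with z h1 h2
    rw [h1, h2]
    simp [mul_comm]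
  have e2 (n : Fin d → ℕ) : ∫ z, inner ℝ ((MemLp.toLp f hf : Lp ℝ 2 _) z) ((ρ n • diagFamily τ u a n :
      Lp ℝ 2 ((normalLaw τ).prod (normalLaw τ))) z) ∂((normalLaw τ).prod (normalLaw τ)) =
      ∫ z, f z * term τ u a ρ n z ∂((normalLaw τ).prod (normalLaw τ)) := by
    refine integral_congr_ae ?_
    filter_upwards [hf.coeFn_toLp, Lp.coeFn_smul (ρ n) (diagFamily τ u a n),
      (memLp_psi_pair (u := u) (a := a) (τ := τ) n).coeFn_toLp] with z h1 h2 h3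
    rw [h1, h2, Pi.smul_apply, diagFamily, h3, term_eq hτ hu]
    simp
    ring
  rw [e1] at h
  simpa only [e2] using h

lemma IsL2Sum.integral_psi (hτ : ∀ i, 0 < τ i) (hu : IsOrthogonalBasis (prob τ) u a)
    {ρ : (Fin d → ℕ) → ℝ} {k : (Fin d → ℝ) × (Fin d → ℝ) → ℝ} (hk : IsL2Sum τ u a ρ k)
    (m n : Fin d → ℕ) :
    ∫ z, (psi τ u a m z.1 * psi τ u a n z.2) * k z ∂((normalLaw τ).prod (normalLaw τ)) =
      if m = n then ρ n * multiFact n else 0 :=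
  (hk.hasSum_integral hτ hu ((pairMoments_prod τ).psi_mul_psi m n).memLp_two).unique
    (hasSum_psi_mul_term hτ hu ρ m n)

lemma IsL2Sum.hasPsiMoments_of_nonneg (hτ : ∀ i, 0 < τ i)
    (hu : IsOrthogonalBasis (prob τ) u a) {ρ : (Fin d → ℕ) → ℝ}
    {k : (Fin d → ℝ) × (Fin d → ℝ) → ℝ} (hk : IsL2Sum τ u a ρ k)
    (h0 : ∀ᵐ z ∂((normalLaw τ).prod (normalLaw τ)), 0 ≤ k z) :
    HasPsiMoments τ u a ρ
      (((normalLaw τ).prod (normalLaw τ)).withDensity fun z => ENNReal.ofReal (k z)) := by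
  intro m n
  rw [← hk.integral_psi hτ hu, integral_withDensity_ofReal hk.1]
  refine integral_congr_ae ?_
  filter_upwards [h0] with z hz
  rw [max_eq_left hz]

/-- Determinacy concerns positive measures, so `k⁻` is moved to the other side: `k⁺ G` and `μ + k⁻
G` have the same Hermite moments and exponential moments, hence are equal. Thus `k⁻ G ≤ k⁺ G`. -/
lemma IsL2Sum.nonneg_of_hasPsiMoments (hτ : ∀ i, 0 < τ i)
    (hu : IsOrthogonalBasis (prob τ) u a) {ρ : (Fin d → ℕ) → ℝ}
    {k : (Fin d → ℝ) × (Fin d → ℝ) → ℝ} (hk : IsL2Sum τ u a ρ k)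
    {μ : Measure ((Fin d → ℝ) × (Fin d → ℝ))} [IsFiniteMeasure μ] (hμ : HasExpMoments μ)
    (h : HasPsiMoments τ u a ρ μ) :
    ∀ᵐ z ∂((normalLaw τ).prod (normalLaw τ)), 0 ≤ k z := by
  set G := (normalLaw τ).prod (normalLaw τ) with hG
  have hGe : HasExpMoments G := IsGaussian.hasExpMoments G
  have hkn : MemLp (fun z => -k z) 2 G := hk.1.neg
  have f1 := isFiniteMeasure_withDensity_of_memLp hk.1
  have f2 := isFiniteMeasure_withDensity_of_memLp hkn
  have key : (G.withDensity fun z => ENNReal.ofReal (k z)) =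
      μ + G.withDensity fun z => ENNReal.ofReal (-k z) := by
    refine ext_of_psi hτ hu (hGe.withDensity hk.1)
      (fun L => (hμ L).add_measure (hGe.withDensity hkn L)) fun m n => ?_
    have hψ := ((pairMoments_prod τ).psi_mul_psi (τ := τ) (u := u) (a := a) m n).memLp_two
    have hn : MemLp (fun z => max (-k z) 0) 2 G := hkn.pos_part
    have i2 : Integrable (fun z => psi τ u a m z.1 * psi τ u a n z.2 * k z) G :=
      hψ.integrable_mul hk.1
    have i3 : Integrable (fun z => psi τ u a m z.1 * psi τ u a n z.2 * max (-k z) 0) G :=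
      hψ.integrable_mul hn
    rw [integral_add_measure (hμ.pairMoments.psi_mul_psi m n).integrable
      (integrable_withDensity_of_memLp hkn hψ), h m n, ← hk.integral_psi hτ hu,
      integral_withDensity_ofReal hk.1, integral_withDensity_ofReal hkn,
      ← hG, ← integral_add i2 i3]
    refine integral_congr_ae (ae_of_all _ fun z => ?_)
    simp only [← mul_add]
    congr 1
    rcases le_total 0 (k z) with h | h
    · rw [max_eq_left h, max_eq_right (by linarith)]; ring
    · rw [max_eq_right h, max_eq_left (by linarith)]; ring
  refine ae_nonneg_of_withDensity_le hk.1 ?_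
  rw [key]
  exact Measure.le_add_left le_rfl

theorem IsL2Sum.nonneg_iff (hτ : ∀ i, 0 < τ i)
    (hu : IsOrthogonalBasis (prob τ) u a) {ρ : (Fin d → ℕ) → ℝ} (hρ : ρ 0 = 1)
    {k : (Fin d → ℝ) × (Fin d → ℝ) → ℝ} (hk : IsL2Sum τ u a ρ k) :
    (∀ᵐ z ∂((normalLaw τ).prod (normalLaw τ)), 0 ≤ k z) ↔
      ∃ φ, IsCubeLaw φ ∧ HasMoments φ ρ := by
  rw [← expansionNonneg_iff_exists_cubeLaw hτ hu hρ]
  constructor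
  · intro h0
    have := isFiniteMeasure_withDensity_of_memLp hk.1
    exact (hk.hasPsiMoments_of_nonneg hτ hu h0).expansionNonneg hτ hu
      ((IsGaussian.hasExpMoments _).withDensity hk.1)
  · intro h
    obtain ⟨μ, _, hμ⟩ := (expansionNonneg_iff_exists_hasExpansion hτ hu hρ).1 h
    exact hk.nonneg_of_hasPsiMoments hτ hu (hasExpMoments_of_marginals hμ.fst_eq hμ.snd_eq)
      (hμ.hasPsiMoments hτ hu)

/-- The marginals are not computed from `k`: non-negativity supplies some law with the expansion,
and determinacy identifies it with the measure of density `k`. -/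
theorem IsL2Sum.hasExpansion_withDensity (hτ : ∀ i, 0 < τ i)
    (hu : IsOrthogonalBasis (prob τ) u a) {ρ : (Fin d → ℕ) → ℝ} (hρ : ρ 0 = 1)
    {k : (Fin d → ℝ) × (Fin d → ℝ) → ℝ} (hk : IsL2Sum τ u a ρ k)
    (h0 : ∀ᵐ z ∂((normalLaw τ).prod (normalLaw τ)), 0 ≤ k z) :
    HasExpansion τ u a ρ
      (((normalLaw τ).prod (normalLaw τ)).withDensity fun z => ENNReal.ofReal (k z)) := by
  have := isFiniteMeasure_withDensity_of_memLp hk.1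
  have he := (IsGaussian.hasExpMoments ((normalLaw τ).prod (normalLaw τ))).withDensity hk.1
  have hp := hk.hasPsiMoments_of_nonneg hτ hu h0
  obtain ⟨μ, _, hμ⟩ := (expansionNonneg_iff_exists_hasExpansion hτ hu hρ).1
    (hp.expansionNonneg hτ hu he)
  rw [HasPsiMoments.unique hτ hu he (hasExpMoments_of_marginals hμ.fst_eq hμ.snd_eq) hp
    (hμ.hasPsiMoments hτ hu)]
  exact hμ

end MeanSquare

end HermiteLancaster

theorem theorem7 {d : ℕ} [NeZero d] (τ : Fin d → ℝ) (hτ : ∀ i, 0 < τ i)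
    (u : Fin d → Fin d → ℝ) (a : Fin d → ℝ)
    (hu : HermiteLancaster.IsOrthogonalBasis (HermiteLancaster.prob τ) u a)
    (ρ : (Fin d → ℕ) → ℝ) (hρ : ρ 0 = 1) :
    (HermiteLancaster.ExpansionNonneg τ u a ρ ↔
      ∃ φ, HermiteLancaster.IsCubeLaw φ ∧ HermiteLancaster.HasMoments φ ρ) ∧
    (HermiteLancaster.ExpansionNonneg τ u a ρ ↔
      ∃ μ, IsProbabilityMeasure μ ∧ HermiteLancaster.HasExpansion τ u a ρ μ) ∧
    (∀ μ, IsProbabilityMeasure μ → HermiteLancaster.HasExpansion τ u a ρ μ →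
      ∀ φ, HermiteLancaster.IsCubeLaw φ →
        (HermiteLancaster.HasMoments φ ρ ↔
          HermiteLancaster.IsConditionallyNormal τ u a φ μ)) ∧
    (∀ φ, HermiteLancaster.IsCubeLaw φ → HermiteLancaster.HasMoments φ ρ →
      ∀ μ, HermiteLancaster.IsConditionallyNormal τ u a φ μ →
        HermiteLancaster.HasExpansion τ u a ρ μ) ∧
    ((Summable fun n => ρ n ^ 2) ↔ ∃ k, HermiteLancaster.IsL2Sum τ u a ρ k) ∧
    (∀ k, HermiteLancaster.IsL2Sum τ u a ρ k →
      ((∀ᵐ z ∂((HermiteLancaster.normalLaw τ).prod (HermiteLancaster.normalLaw τ)), 0 ≤ k z) ↔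
        ∃ φ, HermiteLancaster.IsCubeLaw φ ∧ HermiteLancaster.HasMoments φ ρ) ∧
      ((∀ᵐ z ∂((HermiteLancaster.normalLaw τ).prod (HermiteLancaster.normalLaw τ)), 0 ≤ k z) →
        HermiteLancaster.HasExpansion τ u a ρ
          (((HermiteLancaster.normalLaw τ).prod (HermiteLancaster.normalLaw τ)).withDensity
            fun z => ENNReal.ofReal (k z)))) := by
  exact ⟨HermiteLancaster.expansionNonneg_iff_exists_cubeLaw hτ hu hρ,
    HermiteLancaster.expansionNonneg_iff_exists_hasExpansion hτ hu hρ,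
    fun μ _ hμ φ hφ => HermiteLancaster.hasMoments_iff_isConditionallyNormal hτ hu hμ hφ,
    fun φ hφ hm μ h => HermiteLancaster.hasExpansion_of_isConditionallyNormal hτ hu hφ hm h,
    HermiteLancaster.summable_sq_iff_exists_isL2Sum hτ hu ρ,
    fun k hk => ⟨hk.nonneg_iff hτ hu hρ, hk.hasExpansion_withDensity hτ hu hρ⟩⟩
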